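/- A $k$-graph is a $k$-uniform hypergraph; its independence number $\alpha(H)$ is the largest size of a vertex set containing no edge. For integers $k,s,t,n$ let $r_k(s,t;n)$ be the minimum $N$ such that every red/blue coloring of the edges of the complete $k$-graph on $N$ vertices contains a blue complete $k$-graph on $n$ vertices or a set of $s$ vertices containing at least $t$ red edges (and $r_k(s,t;n)=\infty$ if no such $N$ exists). Let $g_k(s)=0$ for $0\le s<k$, and for $s\ge k$ let $g_k(s)$ be the maximum of $\sum_{i=1}^k g_k(s_i)+\prod_{i=1}^k s_i$ over all integers $0\le s_1,\dots,s_k<s$ with $s_1+\cdots+s_k=s$. Write $h_1^{(k)}(s)=t$ if $t\ge 1$, $r_k(s,t-1;n)\le n^{C}$ for some constant $C$ and all large $n$, and $r_k(s,t;n)\ge e^{n^{c}}$ for some constant $c>0$ and all large $n$. **Theorem.** Let $k\ge 4$. For every $s\ge k$, the value $h_1^{(k)}(s)$ exists, is unique, and $$h_1^{(k)}(s)=g_k(s)+1.$$ Moreover, there is a constant $C=C(k)>0$ such that for every $s\ge k$ and every $N>k$ there is an $N$-vertex $k$-graph $H$ with $\alpha(H)\le C\log N$ in which every $s$ vertices span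 at most $g_k(s)$ edges. -/

import Mathlib

open Filter Finset

namespace ErdosHajnal

/-- `g k s` is the function `g_k(s)`: it is `0` for `s < k`, and for `s ≥ k` it is the maximum of
`∑ i, g_k(s_i) + ∏ i, s_i` over all partitions `s_1 + ⋯ + s_k = s` with `0 ≤ s_i < s`
(the condition `s_i < s` is built into `p i : Fin s`). -/
def g (k s : ℕ) : ℕ :=
  if s < k then 0
  else ({p : Fin k → Fin s | ∑ i, (p i : ℕ) = s} : Finset (Fin k → Fin s)).sup
    fun p => ∑ i, g k (p i) + ∏ i, (p i : ℕ)
termination_by s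
decreasing_by exact (p i).isLt

/-- The two colors. -/
inductive EdgeColor
  | red
  | blue

/-- A red/blue coloring of the edges of the complete `k`-uniform hypergraph `K_N^{(k)}` with
vertex set `Fin N`. -/
abbrev EdgeColoring (k N : ℕ) : Type := {e : Finset (Fin N) // e.card = k} → EdgeColor

/-- The number of red edges contained in the vertex set `S`. -/
noncomputable def EdgeColoring.redCount {k N : ℕ} (c : EdgeColoring k N) (S : Finset (Fin N)) : ℕ :=
  Nat.card {e : {e : Finset (Fin N) // e.card = k} // e.1 ⊆ S ∧ c e = EdgeColor.red}

/-- Every red/blue coloring of the edges of `K_N^{(k)}` contains a monochromatic blue copy of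
`K_n^{(k)}` or has a set of `s` vertices which contains at least `t` red edges. -/
def Arrows (k s t n N : ℕ) : Prop :=
  ∀ c : EdgeColoring k N,
    (∃ A : Finset (Fin N), A.card = n ∧
      ∀ e : {e : Finset (Fin N) // e.card = k}, e.1 ⊆ A → c e = EdgeColor.blue) ∨
    (∃ S : Finset (Fin N), S.card = s ∧ t ≤ c.redCount S)

/-- The Ramsey number `r_k(s,t;n)`: the minimum `N` with `Arrows k s t n N`, and `⊤` if there is
no such `N` (which can happen only if `t > s.choose k`). -/
noncomputable def ramsey (k s t n : ℕ) : ℕ∞ :=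
  ⨅ (N : ℕ) (_ : Arrows k s t n N), (N : ℕ∞)

/-- `f n` is (at most) polynomial in `n`. -/
def PolynomiallyBounded (f : ℕ → ℕ∞) : Prop :=
  ∃ C : ℕ, ∀ᶠ n : ℕ in atTop, f n ≤ (n : ℕ∞) ^ C

/-- `f n` is at least exponential in a power of `n`. -/
def AtLeastExpPower (f : ℕ → ℕ∞) : Prop :=
  ∃ c : ℝ, 0 < c ∧ ∀ᶠ n : ℕ in atTop,
    ENNReal.ofReal (Real.exp ((n : ℝ) ^ c)) ≤ ((f n : ℕ∞) : ENNReal)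

/-- `t` is the value `h_1^{(k)}(s)`, i.e. `r_k(s,t-1;n)` is polynomial in `n` while `r_k(s,t;n)`
is at least exponential in a power of `n`. -/
def IsH1 (k s t : ℕ) : Prop :=
  1 ≤ t ∧ PolynomiallyBounded (fun n => ramsey k s (t - 1) n) ∧
    AtLeastExpPower (fun n => ramsey k s t n)

/-- A `k`-graph (that is, a `k`-uniform hypergraph) with vertex set `V`. -/
structure KGraph (k : ℕ) (V : Type*) where
  /-- the edges -/
  edges : Finset (Finset V)
  card_eq : ∀ e ∈ edges, e.card = k

/-- A set of vertices is independent if it contains no edge. -/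
def KGraph.IsIndep {k : ℕ} {V : Type*} (H : KGraph k V) (A : Finset V) : Prop :=
  ∀ e ∈ H.edges, ¬ e ⊆ A

open Classical in
/-- The independence number `α(H)`: the largest size of an independent set. -/
noncomputable def KGraph.indepNum {k : ℕ} {V : Type*} [Fintype V] (H : KGraph k V) : ℕ :=
  ({A : Finset V | H.IsIndep A} : Finset (Finset V)).sup Finset.card

open Classical in
/-- The number of edges spanned by the vertex set `S`. -/
noncomputable def KGraph.spanned {k : ℕ} {V : Type*} (H : KGraph k V) (S : Finset V) : ℕ :=
  {e ∈ H.edges | e ⊆ S}.card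

end ErdosHajnal

/-!
Both parts rest on one `k`-graph. Assign to every ordered pair `(x, y)` of vertices a random role
`ρ x y : Fin k`, to be read as the role that `x` plays towards `y`, and take as edges the copies:
the `k`-sets that can be labelled so that the `i`-th vertex plays the role `i` towards all others.

* **Independence.** A set of `k ^ 2 * l` vertices contains `l ^ 2` candidate edges, no two of which
  share two vertices, so the candidates become copies independently, each with probability bounded
  below in terms of `k`. The set is therefore independent with probability `exp (-Ω(l ^ 2))`, and a
  union bound gives `α = O(log N)` (`exists_role_assignment`).

* **Local sparsity.** For *every* `ρ`, each set `S` spans at most `g k |S|` copies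
  (`card_copies_le_g`). By induction, in a counterexample `S` all degrees are large, namely at least
  those of the extremal configuration (`mul_g_add_le_mul_degree`). If `|S| ≤ k (k - 1)`, such
  degrees force each vertex to play one role only, so that the copies form a `k`-partite
  hypergraph (`card_copies_le_g_of_small`). For larger `S` the AM-GM inequality shows that each `x`
  has a dominant role `c x`, which it plays towards all but a little more than one `k`-th of `S`
  (`exists_dominant_role`). Split `S` by dominant roles. Copies inside the classes are counted by
  induction and copies that are transversal to the partition by the product of the class sizes, as
  in the recursion for `g`. Every remaining (stray) copy contains at least `k - 2` bad pairs, that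
  is, pairs in different classes not playing the roles of these classes. A bad pair lies in few
  copies, since one of its vertices sees the rest of the copy in a small set, but destroys many
  transversals. Hence the destroyed transversals outnumber the stray copies
  (`stray_le_killed_of_five_le` and, by a sharper count using perfect matchings of the four
  classes, `stray_le_killed_of_four`), and the recursion for `g` bounds the number of copies.

Coloring the edges of this `k`-graph red shows that `r_k(s, g_k(s) + 1; n)` is at least exponential
in a power of `n`. That `r_k(s, g_k(s); n)` is polynomial is an argument of Erdős and Hajnal
(`exists_subset_g_le_card_red`): if every `n` vertices span a red edge, then by averaging some `k`
disjoint large blocks have red transversals of density `n ^ (-k)`. From such a dense relation one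
extracts, block after block, subsets of sizes `s_1, …, s_k` that by induction span `g_k(s_i)` red
edges each and all of whose transversals are red (`exists_prod_subset_of_dense`). Since an
exponential in a power of `n` exceeds every polynomial and Ramsey numbers are monotone in `t`, the
jump happens exactly at `t = g_k(s) + 1`.
-/

namespace ErdosHajnal

/-! ### Elementary inequalities -/

theorem prod_le_sum_div_card_pow {ι : Type*} (s : Finset ι) (z : ι → ℝ) (hz : ∀ i ∈ s, 0 ≤ z i) :
    ∏ i ∈ s, z i ≤ ((∑ i ∈ s, z i) / s.card) ^ s.card := by
  rcases s.eq_empty_or_nonempty with rfl | hs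
  · simp
  have hc : (0 : ℝ) < s.card := by exact_mod_cast hs.card_pos
  have h := Real.geom_mean_le_arith_mean_weighted s (fun _ => (s.card : ℝ)⁻¹) z
    (fun _ _ => by positivity) (by simp [hc.ne']) hz
  rw [Real.finsetProd_rpow s z hz, ← Finset.mul_sum] at h
  calc ∏ i ∈ s, z i = ((∏ i ∈ s, z i) ^ (s.card : ℝ)⁻¹) ^ s.card :=
        (Real.rpow_inv_natCast_pow (prod_nonneg hz) hs.card_pos.ne').symm
    _ ≤ ((s.card : ℝ)⁻¹ * ∑ i ∈ s, z i) ^ s.card :=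
        pow_le_pow_left₀ (Real.rpow_nonneg (prod_nonneg hz) _) h _
    _ = _ := by rw [div_eq_inv_mul]

theorem sum_pow_le_pow_sum {ι : Type*} (s : Finset ι) (f : ι → ℝ) (hf : ∀ i ∈ s, 0 ≤ f i)
    {n : ℕ} (hn : n ≠ 0) : ∑ i ∈ s, f i ^ n ≤ (∑ i ∈ s, f i) ^ n := by
  classical
  induction s using Finset.induction_on with
  | empty => simp [hn]
  | insert a s ha ih =>
    rw [sum_insert ha, sum_insert ha]
    have h1 := ih fun i hi => hf i (mem_insert_of_mem hi)
    have h2 : 0 ≤ ∑ i ∈ s, f i := sum_nonneg fun i hi => hf i (mem_insert_of_mem hi)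
    have h3 := pow_add_pow_le (hf a (mem_insert_self a s)) h2 hn
    linarith

/-- Expanding the product of sums gives all the products of the left side, and more. -/
theorem sum_prod_le_prod_sum {ι κ : Type*} {s : Finset ι} (hs : s.Nonempty) (I : Finset κ)
    (x : κ → ι → ℕ) : ∑ c ∈ I, ∏ j ∈ s, x c j ≤ ∏ j ∈ s, ∑ c ∈ I, x c j := by
  classical
  induction hs using Finset.Nonempty.cons_induction with
  | singleton a => simp
  | cons a s ha hs ih =>
    simp only [prod_cons]
    refine le_trans ?_ (Nat.mul_le_mul_left _ ih)
    rw [sum_mul]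
    refine sum_le_sum fun c hc => Nat.mul_le_mul_left _ ?_
    exact single_le_sum (f := fun c => ∏ j ∈ s, x c j) (fun _ _ => Nat.zero_le _) hc

theorem prod_add_prod_le_prod_add_pred {ι : Type*} {s : Finset ι} (a c : ι → ℕ)
    (ha : ∀ j ∈ s, 1 ≤ a j) (hc : ∀ j ∈ s, 1 ≤ c j) :
    ∏ j ∈ s, a j + ∏ j ∈ s, c j ≤ ∏ j ∈ s, (a j + c j - 1) + 1 := by
  classical
  induction s using Finset.induction_on with
  | empty => simp
  | insert x s hx ih =>
    rw [prod_insert hx, prod_insert hx, prod_insert hx]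
    have h1 := ih (fun j hj => ha j (mem_insert_of_mem hj)) fun j hj => hc j (mem_insert_of_mem hj)
    obtain ⟨p, hp⟩ := Nat.exists_eq_add_of_le (ha x (mem_insert_self x s))
    obtain ⟨r, hr⟩ := Nat.exists_eq_add_of_le (hc x (mem_insert_self x s))
    have hA : 1 ≤ ∏ j ∈ s, a j :=
      Nat.succ_le_of_lt <| prod_pos fun j hj => ha j (mem_insert_of_mem hj)
    have hC : 1 ≤ ∏ j ∈ s, c j :=
      Nat.succ_le_of_lt <| prod_pos fun j hj => hc j (mem_insert_of_mem hj)
    generalize ∏ j ∈ s, a j = A at *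
    generalize ∏ j ∈ s, c j = C at *
    obtain ⟨u, rfl⟩ := Nat.exists_eq_add_of_le hA
    obtain ⟨w, rfl⟩ := Nat.exists_eq_add_of_le hC
    rw [hp, hr, show 1 + p + (1 + r) - 1 = 1 + p + r by omega]
    have h2 : 1 + u + w ≤ ∏ j ∈ s, (a j + c j - 1) := by omega
    nlinarith [Nat.mul_le_mul_left (1 + p + r) h2, Nat.zero_le (p * w), Nat.zero_le (r * u)]

/-! ### The function `g` -/

theorem g_of_lt {k s : ℕ} (h : s < k) : g k s = 0 := by
  rw [g, if_pos h]

theorem sum_g_add_prod_le_g {k s : ℕ} (h : k ≤ s) (t : Fin k → ℕ) (ht : ∀ i, t i < s)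
    (hsum : ∑ i, t i = s) : ∑ i, g k (t i) + ∏ i, t i ≤ g k s := by
  conv_rhs => rw [g, if_neg (not_lt.2 h)]
  exact le_sup (f := fun p : Fin k → Fin s => ∑ i, g k (p i) + ∏ i, (p i : ℕ))
    (b := fun i => (⟨t i, ht i⟩ : Fin s)) (by simpa using hsum)

theorem exists_partition_eq_g {k s : ℕ} (hk : 2 ≤ k) (h : k ≤ s) : ∃ t : Fin k → ℕ,
    (∀ i, t i < s) ∧ ∑ i, t i = s ∧ g k s = ∑ i, g k (t i) + ∏ i, t i := by
  have hne : ({p : Fin k → Fin s | ∑ i, (p i : ℕ) = s} : Finset (Fin k → Fin s)).Nonempty := by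
    obtain ⟨m, rfl⟩ : ∃ m, k = m + 1 + 1 := ⟨k - 2, by omega⟩
    refine ⟨fun i => if i.val = 0 then ⟨s - 1, by omega⟩ else
      if i.val = 1 then ⟨1, by omega⟩ else ⟨0, by omega⟩, ?_⟩
    rw [mem_filter]
    refine ⟨mem_univ _, ?_⟩
    rw [Fin.sum_univ_succ, Fin.sum_univ_succ]
    simp
    omega
  obtain ⟨p, hp, hp'⟩ := exists_mem_eq_sup _ hne
    (fun p : Fin k → Fin s => ∑ i, g k (p i) + ∏ i, (p i : ℕ))
  refine ⟨fun i => p i, fun i => (p i).isLt, by simpa using hp, ?_⟩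
  conv_lhs => rw [g, if_neg (not_lt.2 h)]
  exact hp'

/-- A part of size `s` forces the product to vanish, so no condition on the parts is needed. -/
theorem prod_le_g {k : ℕ} (hk : 2 ≤ k) (t : Fin k → ℕ) : ∏ i, t i ≤ g k (∑ i, t i) := by
  by_cases h0 : ∃ i, t i = 0
  · obtain ⟨i, hi⟩ := h0
    rw [prod_eq_zero (mem_univ i) hi]
    exact Nat.zero_le _
  push Not at h0
  have h1 : k ≤ ∑ i, t i := by
    calc k = ∑ _i : Fin k, 1 := by simp
      _ ≤ _ := sum_le_sum fun i _ => Nat.one_le_iff_ne_zero.2 (h0 i)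
  refine le_trans (Nat.le_add_left _ _) (sum_g_add_prod_le_g h1 t (fun i => ?_) rfl)
  obtain ⟨j, hj⟩ : ∃ j : Fin k, j ≠ i := by
    have : Nontrivial (Fin k) := Fin.nontrivial_iff_two_le.2 hk
    exact exists_ne i
  exact single_lt_sum hj (mem_univ i) (mem_univ j) (Nat.pos_of_ne_zero (h0 j))
    fun _ _ _ => Nat.zero_le _

/-- Enlarging one part of an optimal partition of `t` by a single element, and averaging over the
choice of that part with weights proportional to the sizes of the parts. -/
theorem add_mul_g_le_mul_g_succ {k : ℕ} (hk : 2 ≤ k) (t : ℕ) :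
    (t + k) * g k t ≤ t * g k (t + 1) := by
  induction t using Nat.strong_induction_on with
  | _ t ih =>
    rcases lt_or_ge t k with h | h
    · simp [g_of_lt h]
    obtain ⟨p, hp, hsum, hg⟩ := exists_partition_eq_g hk h
    have key : ∀ i, g k t + g k (p i + 1) + ∏ j ∈ univ.erase i, p j ≤ g k (t + 1) + g k (p i) := by
      intro i
      have h1 := sum_g_add_prod_le_g (k := k) (s := t + 1) (by omega)
        (Function.update p i (p i + 1))
        (fun j => by
          rcases eq_or_ne j i with rfl | hj
          · simpa using hp j
          · rw [Function.update_of_ne hj]; have := hp j; omega)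
        (by
          rw [sum_update_of_mem (mem_univ i), ← hsum, ← add_sum_erase _ p (mem_univ i),
            sdiff_singleton_eq_erase]; ring)
      rw [prod_update_of_mem (mem_univ i), ← add_sum_erase _ _ (mem_univ i),
        sdiff_singleton_eq_erase, Function.update_self] at h1
      have h2 : ∑ j ∈ univ.erase i, g k (Function.update p i (p i + 1) j)
          = ∑ j ∈ univ.erase i, g k (p j) :=
        sum_congr rfl fun j hj => by rw [Function.update_of_ne (ne_of_mem_erase hj)]
      have h3 := add_sum_erase univ (fun j => g k (p j)) (mem_univ i)
      have h4 := mul_prod_erase univ p (mem_univ i)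
      rw [h2] at h1
      nlinarith
    have h5 : ∑ i, p i * (g k t + g k (p i + 1) + ∏ j ∈ univ.erase i, p j)
        ≤ ∑ i, p i * (g k (t + 1) + g k (p i)) :=
      sum_le_sum fun i _ => Nat.mul_le_mul_left _ (key i)
    have h6 : ∑ i, (p i + k) * g k (p i) ≤ ∑ i, p i * g k (p i + 1) :=
      sum_le_sum fun i _ => ih (p i) (hp i)
    have h7 : ∑ i, p i * ∏ j ∈ univ.erase i, p j = k * ∏ i, p i := by
      simp [mul_prod_erase]
    simp only [mul_add, add_mul, sum_add_distrib, ← sum_mul, hsum, h7, ← mul_sum] at h5 h6 ⊢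
    have h8 : k * g k t = k * ∑ i, g k (p i) + k * ∏ i, p i := by rw [hg]; ring
    omega

theorem balanced_prod_le_g {k : ℕ} (hk : 2 ≤ k) (n : ℕ) :
    (n / k + 1) ^ (n % k) * (n / k) ^ (k - n % k) ≤ g k n := by
  have hr : n % k < k := Nat.mod_lt _ (by omega)
  have hc : (univ.filter fun i : Fin k => i.val < n % k).card = n % k := by
    rw [Fin.card_filter_val_lt]; exact min_eq_right hr.le
  have hc' : (univ.filter fun i : Fin k => ¬ i.val < n % k).card = k - n % k := by
    rw [filter_not, card_sdiff_of_subset (filter_subset _ _), hc, card_univ, Fintype.card_fin]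
  have h := prod_le_g hk fun i : Fin k => if i.val < n % k then n / k + 1 else n / k
  rw [prod_ite, sum_ite] at h
  simp only [prod_const, sum_const, hc, hc', smul_eq_mul] at h
  rwa [show n % k * (n / k + 1) + (k - n % k) * (n / k) = n by
    have h1 := Nat.div_add_mod n k
    obtain ⟨m, hm⟩ := Nat.exists_eq_add_of_lt hr
    have : k - n % k = m + 1 := by omega
    rw [this]
    calc _ = (n % k + m + 1) * (n / k) + n % k := by ring
      _ = n := by rw [← hm]; exact h1] at h

/-- The part sizes of a balanced partition have mean `n / k` and differ by at most one, so by the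
inequality between the harmonic and the geometric mean little is lost against `(n / k) ^ k`. -/
theorem fifteen_sixteenths_mul_pow_le_g_of_five_le {k : ℕ} (hk : 5 ≤ k) {n : ℕ}
    (hn : k * (k - 1) ≤ n) :
    15 / 16 * ((n : ℝ) / k) ^ k ≤ g k n := by
  have hr : n % k < k := Nat.mod_lt _ (by omega)
  have hq : k - 1 ≤ n / k := (Nat.le_div_iff_mul_le (by omega)).2 (by rw [mul_comm]; exact hn)
  have hdm := Nat.div_add_mod n k
  have hb : (((n / k + 1) ^ (n % k) * (n / k) ^ (k - n % k) : ℕ) : ℝ) ≤ g k n := by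
    exact_mod_cast balanced_prod_le_g (by omega) n
  refine le_trans ?_ hb
  push_cast
  obtain ⟨q, hqe⟩ : ∃ q, q = n / k := ⟨_, rfl⟩
  obtain ⟨r, hre⟩ : ∃ r, r = n % k := ⟨_, rfl⟩
  rw [← hqe] at hq hdm ⊢
  rw [← hre] at hr hdm ⊢
  have hk0 : (0 : ℝ) < k := by positivity
  have hkr : (5 : ℝ) ≤ k := by exact_mod_cast hk
  have hqr : (k : ℝ) - 1 ≤ q := by
    have : k ≤ q + 1 := by omega
    have : (k : ℝ) ≤ q + 1 := by exact_mod_cast this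
    linarith
  have hq0 : (0 : ℝ) < q := by linarith
  have hrk : (r : ℝ) ≤ k := by exact_mod_cast hr.le
  have hr0 : (0 : ℝ) ≤ r := by positivity
  have hn' : (n : ℝ) = k * q + r := by exact_mod_cast hdm.symm
  set N : ℝ := (n : ℝ) / k with hN
  have hNk : N * k = k * q + r := by rw [hN, ← hn']; field_simp
  have hN0 : 0 < N := by
    have : (0 : ℝ) < k * q + r := by positivity
    rw [hN, hn']; positivity
  set x : ℝ := 1 / (16 * k) with hx
  -- the mean of `N / q` and `N / (q + 1)` with multiplicities `k - r` and `r`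
  have hmean : ((k - r) * (N / q) + r * (N / (q + 1))) / k ≤ 1 + x := by
    rw [div_le_iff₀ hk0]
    have e1 : (k - r) * (N / q) + r * (N / (q + 1))
        = k + r * (k - r) / (k * (q * (q + 1))) := by
      have : N = (k * q + r) / k := by rw [← hNk]; field_simp
      rw [this]; field_simp; ring
    rw [e1, add_mul, one_mul, hx]
    have e2 : 1 / (16 * (k : ℝ)) * k = 1 / 16 := by field_simp
    rw [e2]
    have h3 : (r : ℝ) * (k - r) / (k * (q * (q + 1))) ≤ 1 / 16 := by
      rw [div_le_iff₀ (by positivity)]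
      have h1 : (r : ℝ) * (k - r) ≤ k ^ 2 / 4 := by nlinarith [sq_nonneg ((k : ℝ) - 2 * r)]
      have h2 : (k - 1) * (k : ℝ) ≤ q * (q + 1) := by nlinarith
      nlinarith [mul_le_mul_of_nonneg_left h2 hk0.le, mul_nonneg hk0.le hk0.le]
    linarith
  have hamgm := prod_le_sum_div_card_pow (univ : Finset (Fin k))
    (fun i => if i.val < r then N / (q + 1) else N / q)
    (fun i _ => by split_ifs <;> positivity)
  have hc : (univ.filter fun i : Fin k => i.val < r).card = r := by
    rw [Fin.card_filter_val_lt]; exact min_eq_right hr.le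
  have hc' : (univ.filter fun i : Fin k => ¬ i.val < r).card = k - r := by
    rw [filter_not, card_sdiff_of_subset (filter_subset _ _), hc, card_univ, Fintype.card_fin]
  rw [prod_ite, sum_ite] at hamgm
  simp only [prod_const, sum_const, hc, hc', card_univ, Fintype.card_fin, nsmul_eq_mul] at hamgm
  rw [Nat.cast_sub hr.le, add_comm ((r : ℝ) * _)] at hamgm
  have h4 : (N / (q + 1)) ^ r * (N / q) ^ (k - r) ≤ (1 + x) ^ k := by
    refine hamgm.trans (pow_le_pow_left₀ ?_ hmean k)
    have : (0 : ℝ) ≤ k - r := by linarith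
    positivity
  have hx0 : 0 < x := by rw [hx]; positivity
  have hx1 : x ≤ 1 / 80 := by
    rw [hx]; rw [div_le_div_iff₀ (by positivity) (by norm_num)]; linarith
  -- `(1 + x) ^ k * (15 / 16) ≤ (1 + x) ^ k * (1 - x) ^ k ≤ 1`
  have h5 : (15 / 16 : ℝ) ≤ (1 - x) ^ k := by
    have := one_add_mul_le_pow (a := -x) (by linarith) k
    have e : (k : ℝ) * x = 1 / 16 := by rw [hx]; field_simp
    calc (15 / 16 : ℝ) = 1 + k * (-x) := by linarith
      _ ≤ (1 + -x) ^ k := this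
      _ = _ := by ring
  have h6 : (1 + x) ^ k * (15 / 16) ≤ 1 := by
    calc (1 + x) ^ k * (15 / 16) ≤ (1 + x) ^ k * (1 - x) ^ k :=
          mul_le_mul_of_nonneg_left h5 (by positivity)
      _ = (1 - x ^ 2) ^ k := by rw [← mul_pow]; ring
      _ ≤ 1 := pow_le_one₀ (by nlinarith) (by nlinarith)
  have h7 : N ^ k = (N / (q + 1)) ^ r * (N / q) ^ (k - r) * ((q + 1) ^ r * q ^ (k - r)) := by
    rw [div_pow N, div_pow N]
    have : N ^ k = N ^ r * N ^ (k - r) := by rw [← pow_add]; congr 1; omega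
    rw [this]; field_simp
  rw [h7]
  have h8 : (0 : ℝ) ≤ ((q + 1) ^ r * q ^ (k - r)) := by positivity
  nlinarith [mul_le_mul_of_nonneg_right h4 h8, mul_le_mul_of_nonneg_right h6 h8]

/-- For `k = 4` a more precise estimate than `15 / 16 * (n / 4) ^ 4` is needed. -/
theorem pow_four_sub_le_g {n : ℕ} (hn : 4 ≤ n) :
    ((n : ℝ) / 4) ^ 4 - ((n : ℝ) / 4) ^ 2 / 2 ≤ g 4 n := by
  have hb : (((n / 4 + 1) ^ (n % 4) * (n / 4) ^ (4 - n % 4) : ℕ) : ℝ) ≤ g 4 n := by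
    exact_mod_cast balanced_prod_le_g (by omega) n
  refine le_trans ?_ hb
  have hr : n % 4 < 4 := Nat.mod_lt _ (by omega)
  have hdm := Nat.div_add_mod n 4
  have hq : 1 ≤ n / 4 := by omega
  push_cast
  obtain ⟨q, hqe⟩ : ∃ q, q = n / 4 := ⟨_, rfl⟩
  obtain ⟨r, hre⟩ : ∃ r, r = n % 4 := ⟨_, rfl⟩
  rw [← hqe] at hq hdm ⊢
  rw [← hre] at hr hdm ⊢
  have hn' : (n : ℝ) = 4 * q + r := by exact_mod_cast hdm.symm
  have hq1 : (1 : ℝ) ≤ q := by exact_mod_cast hq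
  rw [hn']
  interval_cases r <;> norm_num <;> nlinarith

/-! ### Copies of the pattern in a role assignment -/

/-- Let `ρ x y` be the role that `x` plays towards `y`. A copy of the pattern is a `k`-tuple of
vertices in which the `i`-th vertex plays the role `i` towards all the others. -/
def IsCopy {k : ℕ} {V : Type*} (ρ : V → V → Fin k) (φ : Fin k → V) : Prop :=
  ∀ i j, i ≠ j → ρ (φ i) (φ j) = i

instance {k : ℕ} {V : Type*} (ρ : V → V → Fin k) : DecidablePred (IsCopy ρ) :=
  fun φ => inferInstanceAs (Decidable (∀ i j, i ≠ j → ρ (φ i) (φ j) = i))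

/-- The copies of the pattern with all vertices in `S`. -/
def copies {k : ℕ} {V : Type*} [DecidableEq V] (ρ : V → V → Fin k) (S : Finset V) :
    Finset (Fin k → V) :=
  (Fintype.piFinset fun _ => S).filter (IsCopy ρ)

/-- The vertices of `S` that `x` can see in role `j` in a copy in which `x` has role `i`. -/
def nbr {k : ℕ} {V : Type*} [DecidableEq V] (ρ : V → V → Fin k) (S : Finset V) (x : V)
    (i j : Fin k) : Finset V :=
  S.filter fun y => y ≠ x ∧ ρ x y = i ∧ ρ y x = j

/-- The vertices of `S` towards which `x` plays the role `i`. -/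
def outNbr {k : ℕ} {V : Type*} [DecidableEq V] (ρ : V → V → Fin k) (S : Finset V) (x : V)
    (i : Fin k) : Finset V :=
  S.filter fun y => y ≠ x ∧ ρ x y = i

/-- The trivial upper bound for the number of copies in which `x` has role `i`. -/
def roleProd {k : ℕ} {V : Type*} [DecidableEq V] (ρ : V → V → Fin k) (S : Finset V) (x : V)
    (i : Fin k) : ℕ :=
  ∏ j ∈ univ.erase i, (nbr ρ S x i j).card

theorem exists_ne_ne {k : ℕ} (hk : 3 ≤ k) (i j : Fin k) : ∃ l, l ≠ i ∧ l ≠ j := by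
  have h : (univ \ {i, j} : Finset (Fin k)).Nonempty := by
    rw [← card_pos, card_sdiff_of_subset (subset_univ _), card_univ, Fintype.card_fin]
    have := card_le_two (a := i) (b := j)
    omega
  obtain ⟨l, hl⟩ := h
  have hl' := (mem_sdiff.1 hl).2
  rw [mem_insert, mem_singleton, not_or] at hl'
  exact ⟨l, hl'⟩

theorem IsCopy.injective {k : ℕ} {V : Type*} {ρ : V → V → Fin k} (hk : 3 ≤ k)
    {φ : Fin k → V} (h : IsCopy ρ φ) :
    Function.Injective φ := by
  intro i j hij
  obtain ⟨l, hli, hlj⟩ := exists_ne_ne hk i j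
  rw [← h i l hli.symm, hij, h j l hlj.symm]

theorem sum_card_parts {k : ℕ} {V : Type*} (S : Finset V) (c : V → Fin k) :
    ∑ i, (S.filter fun x => c x = i).card = S.card :=
  (card_eq_sum_card_fiberwise fun _ _ => mem_univ _).symm

theorem prod_card_parts_le_g {k : ℕ} {V : Type*} (hk : 2 ≤ k) (S : Finset V) (c : V → Fin k) :
    ∏ i, (S.filter fun x => c x = i).card ≤ g k S.card := by
  have := prod_le_g hk fun i => (S.filter fun x => c x = i).card
  rwa [sum_card_parts] at this

section
variable {k : ℕ} {V : Type*} [DecidableEq V] {ρ : V → V → Fin k} {S : Finset V}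

theorem mem_copies {φ : Fin k → V} : φ ∈ copies ρ S ↔ (∀ i, φ i ∈ S) ∧ IsCopy ρ φ := by
  simp [copies]

theorem card_copies_at_le (hk : 3 ≤ k) (x : V) (i : Fin k) :
    ((copies ρ S).filter fun φ => φ i = x).card ≤ roleProd ρ S x i := by
  have hsub : ((copies ρ S).filter fun φ => φ i = x) ⊆
      Fintype.piFinset fun j => if j = i then {x} else nbr ρ S x i j := by
    intro φ hφ
    rw [mem_filter, mem_copies] at hφ
    obtain ⟨⟨hS, hc⟩, hx⟩ := hφ
    rw [Fintype.mem_piFinset]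
    intro j
    split_ifs with hj
    · simp [hj, hx]
    · simp only [nbr, mem_filter]
      refine ⟨hS j, fun h => hj ((hc.injective hk) (h.trans hx.symm)), ?_, ?_⟩
      · rw [← hx]; exact hc i j (Ne.symm hj)
      · rw [← hx]; exact hc j i hj
  refine (card_le_card hsub).trans_eq ?_
  rw [Fintype.card_piFinset, ← mul_prod_erase univ _ (mem_univ i)]
  simp only [if_true, card_singleton, one_mul]
  exact prod_congr rfl fun j hj => by rw [if_neg (ne_of_mem_erase hj)]

theorem sum_card_outNbr {x : V} (hx : x ∈ S) : ∑ i, (outNbr ρ S x i).card + 1 = S.card := by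
  rw [← card_erase_add_one hx]
  congr 1
  rw [card_eq_sum_card_fiberwise (f := ρ x) (t := univ) fun _ _ => mem_univ _]
  refine sum_congr rfl fun i _ => congrArg card ?_
  ext y
  simp only [outNbr, mem_filter, mem_erase]
  tauto

theorem sum_card_nbr_le (T : Finset (Fin k)) (x : V) (i : Fin k) :
    ∑ j ∈ T, (nbr ρ S x i j).card ≤ (outNbr ρ S x i).card := by
  rw [← card_biUnion]
  · refine card_le_card fun y hy => ?_
    simp only [mem_biUnion, nbr, outNbr, mem_filter] at hy ⊢
    obtain ⟨j, _, h1, h2, h3, _⟩ := hy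
    exact ⟨h1, h2, h3⟩
  · intro a _ b _ hab
    rw [Function.onFun, disjoint_left]
    intro y hy hy'
    simp only [nbr, mem_filter] at hy hy'
    exact hab (hy.2.2.2.symm.trans hy'.2.2.2)

theorem card_copies_le_erase_add (hk : 3 ≤ k) (x : V) :
    (copies ρ S).card ≤ (copies ρ (S.erase x)).card + ∑ i, roleProd ρ S x i := by
  have h : copies ρ S ⊆ copies ρ (S.erase x) ∪
      univ.biUnion fun i => (copies ρ S).filter fun φ => φ i = x := by
    intro φ hφ
    rw [mem_union, mem_biUnion]
    by_cases hx : ∃ i, φ i = x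
    · obtain ⟨i, hi⟩ := hx
      exact Or.inr ⟨i, mem_univ i, mem_filter.2 ⟨hφ, hi⟩⟩
    · push Not at hx
      rw [mem_copies] at hφ
      exact Or.inl (mem_copies.2 ⟨fun i => mem_erase.2 ⟨hx i, hφ.1 i⟩, hφ.2⟩)
  refine (card_le_card h).trans ((card_union_le _ _).trans ?_)
  gcongr
  exact card_biUnion_le.trans (sum_le_sum fun i _ => card_copies_at_le hk x i)

/-- In a set with more than `g k` copies, minimal with this property, every vertex lies in at least
as many copies as an average vertex of an extremal configuration on one vertex less. -/
theorem mul_g_add_le_mul_degree (hk : 3 ≤ k) {ν : ℕ} {x : V}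
    (hbig : g k (ν + 1) < (copies ρ S).card) (hx : (copies ρ (S.erase x)).card ≤ g k ν) :
    k * g k ν + ν ≤ ν * ∑ i, roleProd ρ S x i := by
  have h1 := card_copies_le_erase_add (ρ := ρ) (S := S) hk x
  have h2 := add_mul_g_le_mul_g_succ (k := k) (by omega) ν
  have h3 : g k (ν + 1) + 1 ≤ g k ν + ∑ i, roleProd ρ S x i := by omega
  nlinarith [Nat.mul_le_mul_left ν h3]

/-- If every vertex only ever plays the role `c x`, the copies form a `k`-partite hypergraph. -/
theorem card_copies_le_prod (c : V → Fin k) :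
    ((copies ρ S).filter fun φ => ∀ i, c (φ i) = i).card
      ≤ ∏ i, (S.filter fun x => c x = i).card := by
  rw [← Fintype.card_piFinset]
  refine card_le_card fun φ hφ => ?_
  rw [mem_filter, mem_copies] at hφ
  rw [Fintype.mem_piFinset]
  exact fun i => mem_filter.2 ⟨hφ.1.1 i, hφ.2 i⟩

end

/-! ### Small sets: every vertex plays a single role -/

/-- A vertex of large degree that plays two roles needs `ν ≥ k (k - 1)`: superposing the
neighbourhoods for the different roles produces a partition of `ν` with a large product. -/
theorem mul_pred_le_of_two_roles {k ν : ℕ} (hk : 2 ≤ k) (a : Fin k → Fin k → ℕ)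
    (hsum : ∑ i, ∑ j ∈ univ.erase i, a i j ≤ ν)
    (hdeg : k * g k ν + ν ≤ ν * ∑ i, ∏ j ∈ univ.erase i, a i j) {i i' : Fin k} (hii : i ≠ i')
    (hi : ∏ j ∈ univ.erase i, a i j ≠ 0) (hi' : ∏ j ∈ univ.erase i', a i' j ≠ 0) :
    k * (k - 1) ≤ ν := by
  have hcard : (univ.erase i).card = k - 1 := by simp [card_erase_of_mem]
  set c : Fin k → ℕ := fun j => ∑ l ∈ univ.erase i, a l (Equiv.swap i l j) with hc
  have hswap : ∀ (l : Fin k) (f : Fin k → ℕ), ∏ j ∈ univ.erase i, f (Equiv.swap i l j)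
      = ∏ j ∈ univ.erase l, f j := by
    intro l f
    refine prod_bij (fun j _ => Equiv.swap i l j) (fun j hj => ?_)
      (fun _ _ _ _ h => (Equiv.swap i l).injective h) (fun j hj => ?_) fun _ _ => rfl
    · refine mem_erase.2 ⟨fun h => ne_of_mem_erase hj ?_, mem_univ _⟩
      simpa using congrArg (Equiv.swap i l) h
    · refine ⟨Equiv.swap i l j, mem_erase.2 ⟨fun h => ne_of_mem_erase hj ?_, mem_univ _⟩, by simp⟩
      simpa using congrArg (Equiv.swap i l) h
  have hswap' : ∀ (l : Fin k) (f : Fin k → ℕ), ∑ j ∈ univ.erase i, f (Equiv.swap i l j)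
      = ∑ j ∈ univ.erase l, f j := by
    intro l f
    have := Equiv.sum_comp (Equiv.swap i l) f
    rw [← add_sum_erase _ f (mem_univ l), ← add_sum_erase _ _ (mem_univ i),
      Equiv.swap_apply_left] at this
    exact Nat.add_left_cancel this
  have ha1 : ∀ j ∈ univ.erase i, 1 ≤ a i j := fun j hj =>
    Nat.one_le_iff_ne_zero.2 (prod_ne_zero_iff.1 hi j hj)
  have hc1 : ∀ j ∈ univ.erase i, 1 ≤ c j := by
    intro j hj
    have h1 : a i' (Equiv.swap i i' j) ≤ c j :=
      single_le_sum (f := fun l => a l (Equiv.swap i l j)) (fun _ _ => Nat.zero_le _)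
        (mem_erase.2 ⟨hii.symm, mem_univ _⟩)
    rw [← hswap i' (a i')] at hi'
    have := prod_ne_zero_iff.1 hi' j hj
    omega
  have hne : (univ.erase i).Nonempty := ⟨i', mem_erase.2 ⟨hii.symm, mem_univ _⟩⟩
  have hR : ∑ l ∈ univ.erase i, ∏ j ∈ univ.erase l, a l j ≤ ∏ j ∈ univ.erase i, c j := by
    refine le_trans (le_of_eq ?_) (sum_prod_le_prod_sum hne _ _)
    exact sum_congr rfl fun l _ => (hswap l (a l)).symm
  have hQ := prod_add_prod_le_prod_add_pred (s := univ.erase i) (a i) c ha1 hc1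
  set Q := ∏ j ∈ univ.erase i, (a i j + c j - 1) with hQd
  have hsc : ∑ j ∈ univ.erase i, c j = ∑ l ∈ univ.erase i, ∑ j ∈ univ.erase l, a l j := by
    rw [hc, sum_comm]
    exact sum_congr rfl fun l _ => hswap' l (a l)
  have hsQ : ∑ j ∈ univ.erase i, (a i j + c j - 1) + (k - 1) ≤ ν := by
    have h1 : ∑ j ∈ univ.erase i, (a i j + c j - 1) + (k - 1)
        = ∑ j ∈ univ.erase i, (a i j + c j) := by
      rw [← hcard, card_eq_sum_ones, ← sum_add_distrib]
      refine sum_congr rfl fun j hj => ?_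
      have := ha1 j hj
      omega
    rw [h1, sum_add_distrib, hsc, add_sum_erase univ (fun l => ∑ j ∈ univ.erase l, a l j)
      (mem_univ i)]
    exact hsum
  have hg : (k - 1) * Q ≤ g k ν := by
    have h1 := prod_le_g hk (Function.update (fun j => a i j + c j - 1) i
      (ν - ∑ j ∈ univ.erase i, (a i j + c j - 1)))
    rw [prod_update_of_mem (mem_univ i), sum_update_of_mem (mem_univ i),
      sdiff_singleton_eq_erase, Nat.sub_add_cancel (by omega)] at h1
    exact le_trans (Nat.mul_le_mul_right _ (by omega)) h1
  have hd : ∑ l, ∏ j ∈ univ.erase l, a l j ≤ Q + 1 := by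
    rw [← add_sum_erase univ _ (mem_univ i)]
    omega
  have hQ1 : 1 ≤ Q := by
    have : 1 ≤ ∏ j ∈ univ.erase i, a i j := Nat.one_le_iff_ne_zero.2 hi
    have : 1 ≤ ∏ j ∈ univ.erase i, c j := Nat.succ_le_of_lt (prod_pos hc1)
    omega
  have h1 := hdeg.trans (Nat.mul_le_mul_left ν hd)
  have h2 : k * ((k - 1) * Q) ≤ ν * Q := by
    have := Nat.mul_le_mul_left k hg
    rw [mul_add, mul_one] at h1
    omega
  rw [← mul_assoc] at h2
  exact Nat.le_of_mul_le_mul_right h2 hQ1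

theorem card_copies_le_g_of_small {k : ℕ} {V : Type*} [DecidableEq V] {ρ : V → V → Fin k}
    {S : Finset V} (hk : 3 ≤ k) (hS : S.card ≤ k * (k - 1))
    (ih : ∀ x ∈ S, (copies ρ (S.erase x)).card ≤ g k (S.card - 1)) :
    (copies ρ S).card ≤ g k S.card := by
  by_contra! hbig
  have huniq : ∀ φ ∈ copies ρ S, ∀ φ' ∈ copies ρ S, ∀ i i', φ i = φ' i' → i = i' := by
    intro φ hφ φ' hφ' i i' h
    by_contra hii
    have hx : φ i ∈ S := (mem_copies.1 hφ).1 i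
    have hcp : 0 < S.card := card_pos.2 ⟨_, hx⟩
    obtain ⟨ν, hν⟩ : ∃ ν, S.card = ν + 1 := ⟨S.card - 1, by omega⟩
    have hpos : ∀ ψ ∈ copies ρ S, ∀ l, ψ l = φ i → roleProd ρ S (φ i) l ≠ 0 := by
      intro ψ hψ l hl
      have h1 := card_copies_at_le (ρ := ρ) (S := S) hk (φ i) l
      have h2 : 0 < ((copies ρ S).filter fun φ' => φ' l = φ i).card :=
        card_pos.2 ⟨ψ, mem_filter.2 ⟨hψ, hl⟩⟩
      omega
    have hdeg := mul_g_add_le_mul_degree (ν := ν) hk (hν ▸ hbig)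
      (by have := ih _ hx; rwa [hν] at this)
    have hsum : ∑ l, ∑ j ∈ univ.erase l, (nbr ρ S (φ i) l j).card ≤ ν := by
      have h1 := sum_card_outNbr (ρ := ρ) hx
      have h2 : ∑ l, ∑ j ∈ univ.erase l, (nbr ρ S (φ i) l j).card
          ≤ ∑ l, (outNbr ρ S (φ i) l).card :=
        sum_le_sum fun l _ => sum_card_nbr_le _ _ _
      omega
    have := mul_pred_le_of_two_roles (by omega) (fun l j => (nbr ρ S (φ i) l j).card) hsum hdeg hii
      (hpos φ hφ i rfl) (hpos φ' hφ' i' h.symm)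
    omega
  classical
  have hk0 : 0 < k := by omega
  let c : V → Fin k := fun x =>
    if h : ∃ φ ∈ copies ρ S, ∃ i, φ i = x then h.choose_spec.2.choose else ⟨0, hk0⟩
  have hc : ∀ φ ∈ copies ρ S, ∀ i, c (φ i) = i := by
    intro φ hφ i
    have h : ∃ ψ ∈ copies ρ S, ∃ j, ψ j = φ i := ⟨φ, hφ, i, rfl⟩
    have h1 : c (φ i) = h.choose_spec.2.choose := dif_pos h
    rw [h1]
    exact huniq _ h.choose_spec.1 _ hφ _ _ h.choose_spec.2.choose_spec
  have h1 := card_copies_le_prod (ρ := ρ) (S := S) c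
  rw [filter_true_of_mem hc] at h1
  have h2 := prod_card_parts_le_g (by omega : 2 ≤ k) S c
  omega

/-! ### Large sets: every vertex has a dominant role -/

theorem mul_pow_pred_pred_le {K : ℕ} (hK : 3 ≤ K) :
    ((K : ℝ) + 1) * (K - 1) ^ (K - 1) ≤ 15 / 16 * (K : ℝ) ^ K := by
  obtain ⟨L, rfl⟩ : ∃ L, K = L + 1 := ⟨K - 1, by omega⟩
  have hL : (2 : ℝ) ≤ L := by exact_mod_cast (by omega : 2 ≤ L)
  have hL0 : (0 : ℝ) < L := by linarith
  have h1 : 2 * (L : ℝ) ^ L ≤ (L + 1) ^ L := by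
    have h0 : (0 : ℝ) ≤ 1 / L := by positivity
    have h := one_add_mul_le_pow (a := (1 : ℝ) / L) (by linarith) L
    have e : (1 : ℝ) + L * (1 / L) = 2 := by field_simp; norm_num
    rw [e] at h
    calc 2 * (L : ℝ) ^ L ≤ (1 + 1 / L) ^ L * (L : ℝ) ^ L := by gcongr
      _ = (L + 1) ^ L := by rw [← mul_pow]; congr 1; field_simp
  simp only [Nat.add_sub_cancel]
  push_cast
  rw [pow_succ, show (L : ℝ) + 1 - 1 = L by ring]
  have h2 : (0 : ℝ) ≤ (L : ℝ) ^ L := by positivity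
  nlinarith [mul_le_mul_of_nonneg_left h1 (by linarith : (0 : ℝ) ≤ L + 1)]

theorem pow_mul_le_pow_four_mul {K : ℕ} (hK : 3 ≤ K) {μ : ℝ} (h0 : 0 ≤ μ) (h2 : μ ≤ 2) :
    27 * μ ^ (K + 1) ≤ μ ^ 4 * (K : ℝ) ^ K := by
  induction K, hK using Nat.le_induction with
  | base => norm_num; linarith
  | succ K hK ih =>
    have hKr : (3 : ℝ) ≤ K := by exact_mod_cast hK
    have h3 : (K : ℝ) ^ K ≤ (K + 1) ^ K := pow_le_pow_left₀ (by linarith) (by linarith) K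
    have h4 : (0 : ℝ) ≤ (K : ℝ) ^ K := by positivity
    push_cast
    calc 27 * μ ^ (K + 1 + 1) = μ * (27 * μ ^ (K + 1)) := by ring
      _ ≤ μ * (μ ^ 4 * (K : ℝ) ^ K) := by gcongr
      _ = μ ^ 4 * (μ * (K : ℝ) ^ K) := by ring
      _ ≤ μ ^ 4 * ((K + 1) * (K + 1) ^ K) := by
        gcongr
        linarith
      _ = μ ^ 4 * (K + 1) ^ (K + 1) := by ring

theorem fifteen_sixteenths_mul_pow_le_g {k : ℕ} (hk : 4 ≤ k) {n : ℕ} (hn : k * (k - 1) ≤ n) :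
    15 / 16 * ((n : ℝ) / k) ^ k ≤ g k n := by
  rcases hk.eq_or_lt with rfl | hk5
  · refine le_trans ?_ (pow_four_sub_le_g (by omega : 4 ≤ n))
    have h : (12 : ℝ) ≤ n := by exact_mod_cast hn
    have h3 : (9 : ℝ) ≤ ((n : ℝ) / 4) ^ 2 := by nlinarith
    push_cast
    nlinarith [sq_nonneg ((n : ℝ) / 4)]
  · exact fifteen_sixteenths_mul_pow_le_g_of_five_le hk5 hn

/-- In a set of more than `k (k - 1)` vertices, a vertex of large degree plays one role towards
all but little more than a `1 / k` fraction of the other vertices: any other distribution of roles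
leaves the products of neighbourhoods below the degree. Here `a i j` is the number of vertices that
play the role `j` towards the given vertex while it plays the role `i` towards them. -/
theorem exists_dominant_role {k ν : ℕ} (hk : 4 ≤ k) (hν : k * (k - 1) ≤ ν)
    (a : Fin k → Fin k → ℕ) (hb : ∑ i, ∑ j ∈ univ.erase i, a i j ≤ ν)
    (hdeg : k * g k ν + ν ≤ ν * ∑ i, ∏ j ∈ univ.erase i, a i j) :
    ∃ i, (ν : ℝ) - (∑ j ∈ univ.erase i, a i j : ℕ) ≤ 21 / 20 * (ν / k) := by
  set b : Fin k → ℕ := fun i => ∑ j ∈ univ.erase i, a i j with hbdef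
  have hG := fifteen_sixteenths_mul_pow_le_g hk hν
  obtain ⟨K, rfl⟩ : ∃ K, k = K + 1 := ⟨k - 1, by omega⟩
  have hK : 3 ≤ K := by omega
  have hKr : (3 : ℝ) ≤ K := by exact_mod_cast hK
  rw [Nat.add_sub_cancel] at hν
  have hν0 : (0 : ℝ) < ν := by
    have : 0 < ν := lt_of_lt_of_le (Nat.mul_pos (by omega) (by omega)) hν
    exact_mod_cast this
  have hk0 : (0 : ℝ) < ((K + 1 : ℕ) : ℝ) := by positivity
  set Y : ℝ := (ν : ℝ) / ((K + 1 : ℕ) : ℝ) with hY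
  have hY0 : 0 < Y := by positivity
  have hνY : (ν : ℝ) = (K + 1) * Y := by rw [hY]; push_cast; field_simp
  set A : Fin (K + 1) → ℕ := fun i => ∏ j ∈ univ.erase i, a i j with hA
  have hdegY : (g (K + 1) ν : ℝ) + Y ≤ Y * ∑ i, (A i : ℝ) := by
    have h1 : (((K + 1 : ℕ) * g (K + 1) ν + ν : ℕ) : ℝ) ≤ ((ν * ∑ i, A i : ℕ) : ℝ) := by
      exact_mod_cast hdeg
    push_cast at h1
    rw [hνY] at h1
    have h2 : (0 : ℝ) < K + 1 := by positivity
    have h3 : (K + 1) * ((g (K + 1) ν : ℝ) + Y) ≤ (K + 1) * (Y * ∑ i, (A i : ℝ)) := by linarith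
    exact le_of_mul_le_mul_left h3 h2
  have hAle : ∀ i, (A i : ℝ) ≤ ((b i : ℝ) / K) ^ K := by
    intro i
    have h1 := prod_le_sum_div_card_pow (univ.erase i) (fun j => (a i j : ℝ))
      fun _ _ => Nat.cast_nonneg _
    rw [card_erase_of_mem (mem_univ i), card_univ, Fintype.card_fin, Nat.add_sub_cancel] at h1
    rw [hA]
    push_cast
    refine h1.trans ?_
    rw [hbdef]
    push_cast
    exact le_rfl
  obtain ⟨i, -, hmax⟩ := exists_max_image univ b ⟨0, mem_univ _⟩
  refine ⟨i, ?_⟩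
  by_contra! hm
  set m : ℝ := (ν : ℝ) - b i with hmdef
  rcases lt_or_ge (2 * Y) m with h2 | h2
  · -- no role is played towards more than `(k - 2) Y` vertices
    have hbi : (b i : ℝ) ≤ (K - 1) * Y := by rw [hmdef, hνY] at h2; linarith
    have h3 : ∑ l, (A l : ℝ) ≤ ν * ((K - 1) * Y) ^ (K - 1) / K ^ K := by
      have e : ∑ l, (b l : ℝ) ≤ ν := by exact_mod_cast hb
      refine le_trans ?_ (div_le_div_of_nonneg_right (mul_le_mul_of_nonneg_right e
        (pow_nonneg (mul_nonneg (by linarith) hY0.le) _)) (by positivity))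
      rw [sum_mul, sum_div]
      refine sum_le_sum fun l _ => (hAle l).trans ?_
      rw [div_pow]
      have e2 : (b l : ℝ) ^ K = b l * (b l : ℝ) ^ (K - 1) := by
        rw [← pow_succ']; congr 1; omega
      rw [e2]
      have : (b l : ℝ) ≤ (K - 1) * Y := le_trans (by exact_mod_cast hmax l (mem_univ l)) hbi
      gcongr
    have h4 : (ν : ℝ) * ((K - 1) * Y) ^ (K - 1) / K ^ K ≤ 15 / 16 * Y ^ K := by
      rw [div_le_iff₀ (by positivity), hνY, mul_pow]
      have e3 : Y ^ K = Y * Y ^ (K - 1) := by rw [← pow_succ']; congr 1; omega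
      have h5 := mul_le_mul_of_nonneg_left (mul_pow_pred_pred_le hK) (by positivity : 0 ≤ Y ^ K)
      rw [e3] at h5 ⊢
      nlinarith
    have h5 : Y * ∑ l, (A l : ℝ) ≤ Y * (15 / 16 * Y ^ K) :=
      mul_le_mul_of_nonneg_left (h3.trans h4) hY0.le
    have h6 : Y * (15 / 16 * Y ^ K) = 15 / 16 * Y ^ (K + 1) := by ring
    linarith
  · have hm0 : 0 < m := by linarith
    have hgm : m * A i ≤ g (K + 1) ν := by
      have h1 := prod_le_g (k := K + 1) (by omega) (Function.update (a i) i
        (ν - ∑ j ∈ univ.erase i, a i j))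
      have hle' : ∑ j ∈ univ.erase i, a i j ≤ ν :=
        (single_le_sum (f := b) (fun _ _ => Nat.zero_le _) (mem_univ i)).trans hb
      rw [prod_update_of_mem (mem_univ i), sum_update_of_mem (mem_univ i),
        sdiff_singleton_eq_erase, Nat.sub_add_cancel hle'] at h1
      have h2 : (((ν - ∑ j ∈ univ.erase i, a i j) * A i : ℕ) : ℝ) ≤ g (K + 1) ν := by
        exact_mod_cast h1
      rwa [Nat.cast_mul, Nat.cast_sub hle'] at h2
    have hR : ∑ l ∈ univ.erase i, (A l : ℝ) ≤ (m / K) ^ K := by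
      refine (sum_le_sum fun l _ => hAle l).trans ?_
      refine (sum_pow_le_pow_sum _ _ (fun _ _ => by positivity) (by omega)).trans ?_
      rw [← sum_div]
      have e : ∑ l ∈ univ.erase i, (b l : ℝ) ≤ m := by
        have h1 := add_sum_erase univ (fun l => (b l : ℝ)) (mem_univ i)
        have h2 : ∑ l, (b l : ℝ) ≤ ν := by exact_mod_cast hb
        rw [hmdef]
        linarith
      gcongr
    rw [← add_sum_erase univ _ (mem_univ i)] at hdegY
    set R := ∑ l ∈ univ.erase i, (A l : ℝ)
    -- with `μ = m / Y`, the other roles contribute more than a fraction `1 - 1 / μ` of the degree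
    obtain ⟨μ, hμ⟩ : ∃ μ, m = μ * Y := ⟨m / Y, by field_simp⟩
    have hμ1 : 21 / 20 < μ := by
      rw [hμ] at hm; exact lt_of_mul_lt_mul_right hm hY0.le
    have hμ2 : μ ≤ 2 := by
      rw [hμ] at h2; exact le_of_mul_le_mul_right h2 hY0
    have h1 : 15 / 16 * Y ^ (K + 1) * (μ - 1) ≤ μ * Y * R := by
      have h3 : (g (K + 1) ν : ℝ) * (μ - 1) ≤ μ * (Y * R) := by
        rw [hμ] at hgm
        nlinarith
      nlinarith [mul_le_mul_of_nonneg_right hG (by linarith : 0 ≤ μ - 1)]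
    have h3 : μ * Y * R ≤ μ * Y * (μ * Y / K) ^ K := by
      rw [← hμ]; gcongr
    have h4 : μ * Y * (μ * Y / K) ^ K = μ ^ (K + 1) / K ^ K * Y ^ (K + 1) := by
      rw [div_pow, mul_pow]; ring
    have h5 : μ ^ (K + 1) / K ^ K ≤ μ ^ 4 / 27 := by
      rw [div_le_div_iff₀ (by positivity) (by norm_num)]
      linarith [pow_mul_le_pow_four_mul hK (by linarith) hμ2]
    have h6 : 15 / 16 * (μ - 1) * Y ^ (K + 1) ≤ μ ^ 4 / 27 * Y ^ (K + 1) := by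
      have := mul_le_mul_of_nonneg_right h5 (by positivity : 0 ≤ Y ^ (K + 1))
      linarith
    have h7 := le_of_mul_le_mul_right h6 (by positivity)
    -- the convex function `μ ^ 4` lies below its chord over `[21 / 20, 2]`
    have h8 : 0 ≤ (μ - 21 / 20) * (2 - μ) := mul_nonneg (by linarith) (by linarith)
    nlinarith [mul_nonneg h8 (sq_nonneg μ), mul_nonneg h8 (by linarith : 0 ≤ μ)]

/-! ### The partition by dominant roles -/

/-- The vertices of `S` towards which `x` does not play the role `c x` in any copy. -/
def away {k : ℕ} {V : Type*} [DecidableEq V] (ρ : V → V → Fin k) (S : Finset V) (c : V → Fin k)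
    (x : V) : Finset V :=
  (S.erase x).filter fun y => ρ x y ≠ c x ∨ ρ y x = c x

/-- A bad pair: two vertices in different classes of the partition `c` that do not play the roles
of their classes towards each other. -/
def IsBad {k : ℕ} {V : Type*} (ρ : V → V → Fin k) (c : V → Fin k) (x y : V) : Prop :=
  c x ≠ c y ∧ ¬(ρ x y = c x ∧ ρ y x = c y)

instance {k : ℕ} {V : Type*} (ρ : V → V → Fin k) (c : V → Fin k) (x y : V) :
    Decidable (IsBad ρ c x y) :=
  inferInstanceAs (Decidable (c x ≠ c y ∧ ¬(ρ x y = c x ∧ ρ y x = c y)))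

/-- The class `i` of the partition `c` of `S`. -/
def part {k : ℕ} {V : Type*} (S : Finset V) (c : V → Fin k) (i : Fin k) : Finset V :=
  S.filter fun x => c x = i

/-- The bad pairs between the classes `i` and `j`. -/
def badPairs {k : ℕ} {V : Type*} (ρ : V → V → Fin k) (S : Finset V) (c : V → Fin k)
    (i j : Fin k) : Finset (V × V) :=
  (part S c i ×ˢ part S c j).filter fun p => IsBad ρ c p.1 p.2

/-- The transversals of the partition `c` that contain a bad pair. -/
def killed {k : ℕ} {V : Type*} [DecidableEq V] (ρ : V → V → Fin k) (S : Finset V)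
    (c : V → Fin k) : Finset (Fin k → V) :=
  (Fintype.piFinset (part S c)).filter fun t => ∃ i j, IsBad ρ c (t i) (t j)

/-- The copies that are neither transversal to the partition `c` nor inside one of its classes. -/
def strayCopies {k : ℕ} {V : Type*} [DecidableEq V] (ρ : V → V → Fin k) (S : Finset V)
    (c : V → Fin k) : Finset (Fin k → V) :=
  (copies ρ S).filter fun φ => (∃ i, c (φ i) ≠ i) ∧ ∃ i j, c (φ i) ≠ c (φ j)

theorem IsBad.symm {k : ℕ} {V : Type*} {ρ : V → V → Fin k} {c : V → Fin k} {x y : V}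
    (h : IsBad ρ c x y) : IsBad ρ c y x :=
  ⟨h.1.symm, fun h' => h.2 h'.symm⟩

theorem mem_part {k : ℕ} {V : Type*} {S : Finset V} {c : V → Fin k} {i : Fin k} {x : V} :
    x ∈ part S c i ↔ x ∈ S ∧ c x = i := mem_filter

/-- Let the vertex `i₀` of a stray copy not play its dominant role, and let `l₀` lie in a different
class. Then `i₀` forms bad pairs with all vertices outside its class, and so does `l₀` with the
vertices in the class of `i₀`, with at most one exception. The pairs are counted in both orders. -/
theorem le_card_bad_pairs_of_stray {k : ℕ} {V : Type*} {ρ : V → V → Fin k} {c : V → Fin k}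
    {φ : Fin k → V} (hφ : IsCopy ρ φ)
    (h1 : ∃ i, c (φ i) ≠ i) (h2 : ∃ i j, c (φ i) ≠ c (φ j)) :
    2 * (k - 2) ≤ ((univ : Finset (Fin k × Fin k)).filter
      fun p => IsBad ρ c (φ p.1) (φ p.2)).card := by
  obtain ⟨i₀, hi₀⟩ := h1
  set J := c (φ i₀) with hJ
  obtain ⟨l₀, hl₀⟩ : ∃ l, c (φ l) ≠ J := by
    obtain ⟨i, j, hij⟩ := h2
    by_contra! h
    exact hij ((h i).trans (h j).symm)
  set E : Finset (Fin k) := univ.filter fun l => c (φ l) ≠ J with hE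
  set F : Finset (Fin k) := univ.filter fun i => c (φ i) = J ∧ i ≠ i₀ ∧ i ≠ J with hF
  have hbad : ∀ i l, c (φ i) = J → i ≠ J → c (φ l) ≠ J → IsBad ρ c (φ i) (φ l) := by
    intro i l hi hiJ hl
    have hil : i ≠ l := fun h => hl (h ▸ hi)
    refine ⟨fun h => hl (h ▸ hi), fun h => hiJ ?_⟩
    rw [← hi, ← h.1, hφ i l hil]
  have hdisj : Disjoint E F := by
    rw [disjoint_left]
    intro i hi hi'
    exact (mem_filter.1 hi).2 (mem_filter.1 hi').2.1
  have hEF : k - 2 ≤ E.card + F.card := by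
    have h : (univ : Finset (Fin k)) ⊆ (E ∪ F) ∪ {i₀, J} := by
      intro i _
      simp only [mem_union, mem_insert, mem_singleton, hE, hF, mem_filter, mem_univ, true_and]
      tauto
    have h' := (card_le_card h).trans (card_union_le _ _)
    rw [card_univ, Fintype.card_fin, card_union_of_disjoint hdisj] at h'
    have := card_le_two (a := i₀) (b := J)
    omega
  set P₁ : Finset (Fin k × Fin k) := ({i₀} ×ˢ E) ∪ (F ×ˢ {l₀}) with hP₁
  have hP₁card : P₁.card = E.card + F.card := by
    rw [hP₁, card_union_of_disjoint, card_product, card_product, card_singleton, card_singleton,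
      one_mul, mul_one]
    rw [disjoint_left]
    rintro ⟨a, b⟩ ha hb
    rw [mem_product, mem_singleton] at ha
    rw [mem_product, hF, mem_filter] at hb
    exact hb.1.2.2.1 ha.1
  have hP₁bad : ∀ p ∈ P₁, c (φ p.1) = J ∧ c (φ p.2) ≠ J ∧ IsBad ρ c (φ p.1) (φ p.2) := by
    rintro ⟨a, b⟩ hp
    rw [hP₁, mem_union, mem_product, mem_product, mem_singleton, mem_singleton] at hp
    rcases hp with ⟨ha, hb⟩ | ⟨ha, hb⟩
    · simp only at ha hb
      have hb' := (mem_filter.1 hb).2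
      subst ha
      exact ⟨rfl, hb', hbad _ _ rfl (Ne.symm hi₀) hb'⟩
    · simp only at ha hb
      have ha' := (mem_filter.1 ha).2
      subst hb
      exact ⟨ha'.1, hl₀, hbad _ _ ha'.1 ha'.2.2 hl₀⟩
  set P₂ := P₁.map (Equiv.prodComm _ _).toEmbedding with hP₂
  have h12 : Disjoint P₁ P₂ := by
    rw [disjoint_left]
    intro p hp hp'
    rw [hP₂, Finset.mem_map] at hp'
    obtain ⟨q, hq, rfl⟩ := hp'
    exact (hP₁bad q hq).2.1 (hP₁bad _ hp).1
  calc 2 * (k - 2) ≤ (P₁ ∪ P₂).card := by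
        rw [card_union_of_disjoint h12, hP₂, card_map, hP₁card]; omega
    _ ≤ _ := by
        refine card_le_card fun p hp => mem_filter.2 ⟨mem_univ _, ?_⟩
        rcases mem_union.1 hp with hp | hp
        · exact (hP₁bad p hp).2.2
        · rw [hP₂, Finset.mem_map] at hp
          obtain ⟨q, hq, rfl⟩ := hp
          exact (hP₁bad q hq).2.2.symm

section
variable {k : ℕ} {V : Type*} [DecidableEq V] {ρ : V → V → Fin k} {S : Finset V} {c : V → Fin k}

/-- The vertices not in `away` are those that `x` sees in some role while playing `c x` itself. -/
theorem card_away_add {x : V} (hx : x ∈ S) :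
    (away ρ S c x).card + ∑ j ∈ univ.erase (c x), (nbr ρ S x (c x) j).card + 1 = S.card := by
  rw [← card_erase_add_one hx, ← card_biUnion]
  · congr 1
    rw [← card_union_of_disjoint]
    · congr 1
      ext y
      simp only [away, nbr, mem_union, mem_filter, mem_erase, mem_biUnion, mem_univ, and_true]
      constructor
      · rintro (h | ⟨j, hj, h1, h2, h3⟩)
        · exact h.1
        · exact ⟨h2, h1⟩
      · intro h
        by_cases h' : ρ x y ≠ c x ∨ ρ y x = c x
        · exact Or.inl ⟨h, h'⟩
        · push Not at h'
          exact Or.inr ⟨ρ y x, h'.2, h.2, h.1, h'.1, rfl⟩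
    · rw [disjoint_left]
      intro y hy hy'
      simp only [away, nbr, mem_filter, mem_biUnion, mem_erase] at hy hy'
      obtain ⟨j, ⟨hj, -⟩, -, -, h1, h2⟩ := hy'
      rcases hy.2 with h | h
      · exact h h1
      · exact hj (h2.symm.trans h)
  · intro a _ b _ hab
    rw [Function.onFun, disjoint_left]
    intro y hy hy'
    simp only [nbr, mem_filter] at hy hy'
    exact hab (hy.2.2.2.symm.trans hy'.2.2.2)

theorem sum_card_nbr_le_card_away (x : V) :
    ∑ i ∈ univ.erase (c x), ∑ j ∈ univ.erase i, (nbr ρ S x i j).card ≤ (away ρ S c x).card := by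
  calc _ ≤ ∑ i ∈ univ.erase (c x), (outNbr ρ S x i).card :=
        sum_le_sum fun i _ => sum_card_nbr_le _ _ _
    _ = ((univ.erase (c x)).biUnion fun i => outNbr ρ S x i).card := by
        rw [card_biUnion]
        intro a _ b _ hab
        rw [Function.onFun, disjoint_left]
        intro y hy hy'
        simp only [outNbr, mem_filter] at hy hy'
        exact hab (hy.2.2.symm.trans hy'.2.2)
    _ ≤ _ := by
        refine card_le_card fun y hy => ?_
        simp only [mem_biUnion, outNbr, away, mem_filter, mem_erase, mem_univ, and_true] at hy ⊢
        obtain ⟨i, hi, h1, h2, h3⟩ := hy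
        exact ⟨⟨h2, h1⟩, Or.inl (h3 ▸ hi)⟩

/-- Copies in which some vertex does not play its dominant role are rare, since such a vertex
sees the rest of the copy in its small set `away`. -/
theorem card_copies_bad_le (hk : 3 ≤ k) {D : ℝ}
    (hD : ∀ x ∈ S, ((away ρ S c x).card : ℝ) ≤ D) :
    (((copies ρ S).filter fun φ => ∃ i, c (φ i) ≠ i).card : ℝ)
      ≤ S.card * (D / (k - 1 : ℕ)) ^ (k - 1) := by
  have h1 : ((copies ρ S).filter fun φ => ∃ i, c (φ i) ≠ i) ⊆ S.biUnion fun x =>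
      (univ.erase (c x)).biUnion fun i => (copies ρ S).filter fun φ => φ i = x := by
    intro φ hφ
    rw [mem_filter] at hφ
    obtain ⟨hφ, i, hi⟩ := hφ
    simp only [mem_biUnion, mem_filter]
    exact ⟨φ i, (mem_copies.1 hφ).1 i, i, mem_erase.2 ⟨hi.symm, mem_univ _⟩, hφ, rfl⟩
  have h2 : ((copies ρ S).filter fun φ => ∃ i, c (φ i) ≠ i).card
      ≤ ∑ x ∈ S, ∑ i ∈ univ.erase (c x), roleProd ρ S x i :=
    (card_le_card h1).trans (card_biUnion_le.trans (sum_le_sum fun x _ =>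
      card_biUnion_le.trans (sum_le_sum fun i _ => card_copies_at_le hk x i)))
  calc (((copies ρ S).filter fun φ => ∃ i, c (φ i) ≠ i).card : ℝ)
      ≤ ((∑ x ∈ S, ∑ i ∈ univ.erase (c x), roleProd ρ S x i : ℕ) : ℝ) := by exact_mod_cast h2
    _ = ∑ x ∈ S, ∑ i ∈ univ.erase (c x), (roleProd ρ S x i : ℝ) := by push_cast; rfl
    _ ≤ ∑ x ∈ S, (D / (k - 1 : ℕ)) ^ (k - 1) := by
      refine sum_le_sum fun x hx => ?_
      have h3 : ∀ i, (roleProd ρ S x i : ℝ)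
          ≤ ((∑ j ∈ univ.erase i, ((nbr ρ S x i j).card : ℝ)) / (k - 1 : ℕ)) ^ (k - 1) := by
        intro i
        have h4 := prod_le_sum_div_card_pow (univ.erase i)
          (fun j => ((nbr ρ S x i j).card : ℝ)) fun _ _ => Nat.cast_nonneg _
        rw [card_erase_of_mem (mem_univ i), card_univ, Fintype.card_fin] at h4
        rw [roleProd]
        push_cast
        exact h4
      refine (sum_le_sum fun i _ => h3 i).trans ?_
      refine (sum_pow_le_pow_sum _ _ (fun _ _ => by positivity) (by omega)).trans ?_
      rw [← sum_div]
      have h5 : ∑ i ∈ univ.erase (c x), ∑ j ∈ univ.erase i, ((nbr ρ S x i j).card : ℝ) ≤ D := by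
        refine le_trans ?_ (hD x hx)
        exact_mod_cast sum_card_nbr_le_card_away (ρ := ρ) (S := S) (c := c) x
      gcongr
    _ = _ := by rw [sum_const, nsmul_eq_mul]

theorem card_copies_at_pair_le (hk : 3 ≤ k) {x y : V} {i j : Fin k} (hij : i ≠ j) :
    ((copies ρ S).filter fun φ => φ i = x ∧ φ j = y).card
      ≤ ∏ l ∈ (univ.erase i).erase j, (nbr ρ S x i l).card := by
  have hji : j ∈ univ.erase i := mem_erase.2 ⟨hij.symm, mem_univ _⟩
  have hsub : ((copies ρ S).filter fun φ => φ i = x ∧ φ j = y) ⊆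
      Fintype.piFinset fun l => if l = i then {x} else if l = j then {y} else nbr ρ S x i l := by
    intro φ hφ
    rw [mem_filter, mem_copies] at hφ
    obtain ⟨⟨hS, hc⟩, hx, hy⟩ := hφ
    rw [Fintype.mem_piFinset]
    intro l
    split_ifs with h1 h2
    · simp [h1, hx]
    · simp [h2, hy]
    · simp only [nbr, mem_filter]
      refine ⟨hS l, fun h => h1 ((hc.injective hk) (h.trans hx.symm)), ?_, ?_⟩
      · rw [← hx]; exact hc i l (Ne.symm h1)
      · rw [← hx]; exact hc l i h1
  refine (card_le_card hsub).trans_eq ?_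
  rw [Fintype.card_piFinset, ← mul_prod_erase univ _ (mem_univ i), ← mul_prod_erase _ _ hji]
  simp only [if_true, card_singleton, one_mul, if_neg hij.symm]
  refine prod_congr rfl fun l hl => ?_
  rw [if_neg (ne_of_mem_erase (mem_of_mem_erase hl)), if_neg (ne_of_mem_erase hl)]

/-- One of the vertices of a bad pair sees the rest of any copy through the pair in its small set
`away`. -/
theorem card_copies_through_bad_le (hk : 3 ≤ k) {D : ℝ}
    (hD : ∀ x ∈ S, ((away ρ S c x).card : ℝ) ≤ D) {x y : V} (hx : x ∈ S) (hy : y ∈ S)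
    (hxy : IsBad ρ c x y) :
    (((copies ρ S).filter fun φ => ∃ i j, φ i = x ∧ φ j = y).card : ℝ)
      ≤ (D / (k - 2 : ℕ)) ^ (k - 2) := by
  have hne : x ≠ y := fun h => hxy.1 (by rw [h])
  -- it suffices to treat the case that `x` does not play its dominant role towards `y`
  have key : ∀ x ∈ S, ∀ y : V, x ≠ y → ρ x y ≠ c x →
      (((copies ρ S).filter fun φ => ∃ i j, φ i = x ∧ φ j = y).card : ℝ)
        ≤ (D / (k - 2 : ℕ)) ^ (k - 2) := by
    intro x hx y hne h
    have hD0 : 0 ≤ D := le_trans (Nat.cast_nonneg _) (hD x hx)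
    have hsub : ((copies ρ S).filter fun φ => ∃ i j, φ i = x ∧ φ j = y) ⊆
        (copies ρ S).filter fun φ => φ (ρ x y) = x ∧ φ (ρ y x) = y := by
      intro φ hφ
      rw [mem_filter] at hφ ⊢
      obtain ⟨hφ, i, j, rfl, rfl⟩ := hφ
      have hij : i ≠ j := fun h => hne (by rw [h])
      have hc := (mem_copies.1 hφ).2
      rw [hc i j hij, hc j i hij.symm]
      exact ⟨hφ, rfl, rfl⟩
    rcases eq_or_ne (ρ x y) (ρ y x) with he | he
    · have : ((copies ρ S).filter fun φ => φ (ρ x y) = x ∧ φ (ρ y x) = y) = ∅ := by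
        refine filter_eq_empty_iff.2 fun φ _ h => hne ?_
        exact h.1.symm.trans ((congrArg φ he).trans h.2)
      rw [this, subset_empty] at hsub
      rw [hsub, card_empty, Nat.cast_zero]
      positivity
    · have h1 := (card_le_card hsub).trans (card_copies_at_pair_le hk he)
      have hcard : ((univ.erase (ρ x y)).erase (ρ y x)).card = k - 2 := by
        rw [card_erase_of_mem (mem_erase.2 ⟨he.symm, mem_univ _⟩),
          card_erase_of_mem (mem_univ _), card_univ, Fintype.card_fin]
        omega
      have h2 := prod_le_sum_div_card_pow ((univ.erase (ρ x y)).erase (ρ y x))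
          (fun j => ((nbr ρ S x (ρ x y) j).card : ℝ)) fun _ _ => Nat.cast_nonneg _
      rw [hcard] at h2
      have h3 : ∑ l ∈ (univ.erase (ρ x y)).erase (ρ y x), (nbr ρ S x (ρ x y) l).card
          ≤ (away ρ S c x).card := by
        refine (sum_card_nbr_le _ x (ρ x y)).trans (card_le_card fun z hz => ?_)
        simp only [outNbr, away, mem_filter, mem_erase] at hz ⊢
        exact ⟨⟨hz.2.1, hz.1⟩, Or.inl (hz.2.2 ▸ h)⟩
      calc _ ≤ ((∏ l ∈ (univ.erase (ρ x y)).erase (ρ y x),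
              (nbr ρ S x (ρ x y) l).card : ℕ) : ℝ) := by
            exact_mod_cast h1
        _ ≤ _ := by push_cast; exact h2
        _ ≤ _ := by
          have : (∑ l ∈ (univ.erase (ρ x y)).erase (ρ y x), ((nbr ρ S x (ρ x y) l).card : ℝ))
              ≤ D := le_trans (by exact_mod_cast h3) (hD x hx)
          gcongr
  by_cases h : ρ x y = c x
  · have h' : ρ y x ≠ c y := fun h' => hxy.2 ⟨h, h'⟩
    have h1 := key y hy x hne.symm h'
    have h2 : ((copies ρ S).filter fun φ => ∃ i j, φ i = x ∧ φ j = y)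
        = (copies ρ S).filter fun φ => ∃ i j, φ i = y ∧ φ j = x := by
      refine filter_congr fun φ _ => ⟨?_, ?_⟩ <;>
      · rintro ⟨i, j, h1, h2⟩
        exact ⟨j, i, h2, h1⟩
    rwa [h2]
  · exact key x hx y hne h

/-- Double counting of the incidences between stray copies and ordered bad pairs. -/
theorem card_strayCopies_le (hk : 3 ≤ k) {D : ℝ}
    (hD : ∀ x ∈ S, ((away ρ S c x).card : ℝ) ≤ D) :
    2 * (k - 2 : ℕ) * ((strayCopies ρ S c).card : ℝ)
      ≤ (∑ i, ∑ j ∈ univ.erase i, ((badPairs ρ S c i j).card : ℝ))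
        * (D / (k - 2 : ℕ)) ^ (k - 2) := by
  set P : Finset (V × V) := (S ×ˢ S).filter fun p => IsBad ρ c p.1 p.2 with hP
  let r : (Fin k → V) → V × V → Prop := fun φ p => ∃ i j, φ i = p.1 ∧ φ j = p.2
  classical
  have hlow : ∀ φ ∈ strayCopies ρ S c, 2 * (k - 2) ≤ (bipartiteAbove r P φ).card := by
    intro φ hφ
    rw [strayCopies, mem_filter, mem_copies] at hφ
    obtain ⟨⟨hS, hc⟩, h1, h2⟩ := hφ
    refine (le_card_bad_pairs_of_stray hc h1 h2).trans ?_
    refine card_le_card_of_injOn (Prod.map φ φ) (fun p hp => ?_)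
      (((hc.injective hk).prodMap (hc.injective hk)).injOn)
    rw [mem_coe, mem_filter] at hp
    rw [mem_coe, bipartiteAbove, mem_filter, hP, mem_filter, mem_product]
    exact ⟨⟨⟨hS _, hS _⟩, hp.2⟩, p.1, p.2, rfl, rfl⟩
  have hup : ∀ p ∈ P, ((bipartiteBelow r (strayCopies ρ S c) p).card : ℝ)
      ≤ (D / (k - 2 : ℕ)) ^ (k - 2) := by
    intro p hp
    rw [hP, mem_filter, mem_product] at hp
    refine le_trans ?_ (card_copies_through_bad_le hk hD hp.1.1 hp.1.2 hp.2)
    refine Nat.cast_le.2 (card_le_card fun φ hφ => ?_)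
    rw [bipartiteBelow, mem_filter, strayCopies, mem_filter] at hφ
    exact mem_filter.2 ⟨hφ.1.1, hφ.2⟩
  have hPcard : (P.card : ℝ) ≤ ∑ i, ∑ j ∈ univ.erase i, ((badPairs ρ S c i j).card : ℝ) := by
    have h : P ⊆ univ.biUnion fun i => (univ.erase i).biUnion fun j => badPairs ρ S c i j := by
      intro p hp
      rw [hP, mem_filter, mem_product] at hp
      simp only [mem_biUnion, badPairs, mem_filter, mem_product, mem_part, mem_univ, true_and,
        mem_erase, and_true]
      exact ⟨c p.1, c p.2, hp.2.1.symm, ⟨⟨hp.1.1, rfl⟩, hp.1.2, rfl⟩, hp.2⟩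
    exact_mod_cast (card_le_card h).trans
      (card_biUnion_le.trans (sum_le_sum fun i _ => card_biUnion_le))
  have hdc := sum_card_bipartiteAbove_eq_sum_card_bipartiteBelow
    (s := strayCopies ρ S c) (t := P) r
  have h1 : 2 * (k - 2) * (strayCopies ρ S c).card
      ≤ ∑ φ ∈ strayCopies ρ S c, (bipartiteAbove r P φ).card := by
    rw [mul_comm]
    exact card_nsmul_le_sum _ _ _ hlow
  rw [hdc] at h1
  calc 2 * (k - 2 : ℕ) * ((strayCopies ρ S c).card : ℝ)
      ≤ ∑ p ∈ P, ((bipartiteBelow r (strayCopies ρ S c) p).card : ℝ) := by exact_mod_cast h1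
    _ ≤ P.card * (D / (k - 2 : ℕ)) ^ (k - 2) := by
        rw [← nsmul_eq_mul]; exact sum_le_card_nsmul _ _ _ hup
    _ ≤ _ := by
        have hD0 : 0 ≤ (D / (k - 2 : ℕ)) ^ (k - 2) ∨ P = ∅ := by
          rcases P.eq_empty_or_nonempty with h | ⟨p, hp⟩
          · exact Or.inr h
          · exact Or.inl (le_trans (Nat.cast_nonneg _) (hup p hp))
        rcases hD0 with h | h
        · gcongr
        · have hC : ∑ i, ∑ j ∈ univ.erase i, ((badPairs ρ S c i j).card : ℝ) = 0 := by
            refine sum_eq_zero fun i _ => sum_eq_zero fun j _ => ?_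
            rw [Nat.cast_eq_zero, card_eq_zero, ← subset_empty, ← h, hP, badPairs]
            exact filter_subset_filter _ (product_subset_product (filter_subset _ _)
              (filter_subset _ _))
          rw [hC, h]; simp

/-- The pairs inside a class are at best one-sided, so some vertex of the class is `away` from half
of it. -/
theorem card_part_le {D : ℝ} (hD : ∀ x ∈ S, ((away ρ S c x).card : ℝ) ≤ D) (i : Fin k)
    (hD0 : 0 ≤ D) : ((part S c i).card : ℝ) ≤ 2 * D + 1 := by
  set U := part S c i with hU
  let r : V → V → Prop := fun x y => y ∈ away ρ S c x
  classical
  have h1 : ∀ x ∈ U, ((bipartiteAbove r U x).card : ℝ) ≤ D := by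
    intro x hx
    refine le_trans (Nat.cast_le.2 (card_le_card fun y hy => ?_)) (hD x (mem_part.1 hx).1)
    exact (mem_filter.1 hy).2
  have h2 : ∀ x ∈ U, U.card ≤ (bipartiteAbove r U x).card + (bipartiteBelow r U x).card + 1 := by
    intro x hx
    have h : U ⊆ (bipartiteAbove r U x ∪ bipartiteBelow r U x) ∪ {x} := by
      intro y hy
      rw [mem_union, mem_union, mem_singleton, bipartiteAbove, bipartiteBelow, mem_filter,
        mem_filter]
      by_cases hxy : y = x
      · exact Or.inr hxy
      left
      have hx' := mem_part.1 hx
      have hy' := mem_part.1 hy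
      simp only [r, away, mem_filter, mem_erase]
      by_cases h3 : ρ x y = i
      · exact Or.inr ⟨hy, ⟨Ne.symm hxy, hx'.1⟩, Or.inr (by rw [h3, hy'.2])⟩
      · exact Or.inl ⟨hy, ⟨hxy, hy'.1⟩, Or.inl (by rwa [hx'.2])⟩
    refine (card_le_card h).trans ((card_union_le _ _).trans ?_)
    have := card_union_le (bipartiteAbove r U x) (bipartiteBelow r U x)
    simp only [card_singleton]
    omega
  rcases Nat.eq_zero_or_pos U.card with h0 | h0
  · rw [h0, Nat.cast_zero]; linarith
  have h3 : U.card * U.card ≤ 2 * ∑ x ∈ U, (bipartiteAbove r U x).card + U.card := by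
    have h4 := sum_le_sum h2
    rw [sum_add_distrib, sum_add_distrib,
      ← sum_card_bipartiteAbove_eq_sum_card_bipartiteBelow (s := U) (t := U) r] at h4
    simp only [sum_const, smul_eq_mul, mul_one] at h4
    omega
  have h5 : (∑ x ∈ U, ((bipartiteAbove r U x).card : ℝ)) ≤ U.card * D := by
    rw [← nsmul_eq_mul]; exact sum_le_card_nsmul _ _ _ h1
  have h6 : (U.card : ℝ) * U.card ≤ 2 * ∑ x ∈ U, ((bipartiteAbove r U x).card : ℝ) + U.card := by
    exact_mod_cast h3
  have h7 : (0 : ℝ) < U.card := by exact_mod_cast h0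
  nlinarith

end

/-! ### Transversals destroyed by bad pairs -/

section
variable {k : ℕ} {V : Type*} [DecidableEq V] {ρ : V → V → Fin k} {S : Finset V} {c : V → Fin k}

/-- The transversals of the partition `c` that contain a bad pair in the classes `i` and `j`. -/
def killedAt (ρ : V → V → Fin k) (S : Finset V) (c : V → Fin k) (i j : Fin k) :
    Finset (Fin k → V) :=
  (Fintype.piFinset (part S c)).filter fun t => IsBad ρ c (t i) (t j)

theorem killedAt_subset (i j : Fin k) : killedAt ρ S c i j ⊆ killed ρ S c := fun _ ht =>
  mem_filter.2 ⟨(mem_filter.1 ht).1, i, j, (mem_filter.1 ht).2⟩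

/-- Every bad pair extends to a transversal by an arbitrary choice in each of the other classes. -/
theorem card_badPairs_mul_le {i j : Fin k} (hij : i ≠ j) :
    (badPairs ρ S c i j).card * ∏ m ∈ (univ.erase i).erase j, (part S c m).card
      ≤ (killedAt ρ S c i j).card := by
  have hji : j ∈ univ.erase i := mem_erase.2 ⟨hij.symm, mem_univ _⟩
  let F : V × V → Finset (Fin k → V) := fun p =>
    Fintype.piFinset fun m => if m = i then {p.1} else if m = j then {p.2} else part S c m
  have hF : ∀ p, ∀ t ∈ F p, t i = p.1 ∧ t j = p.2 := by
    intro p t ht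
    have h := Fintype.mem_piFinset.1 ht
    have h1 := h i
    have h2 := h j
    simp only [if_true, if_neg hij.symm, mem_singleton] at h1 h2
    exact ⟨h1, h2⟩
  have hcard : ∀ p, (F p).card = ∏ m ∈ (univ.erase i).erase j, (part S c m).card := by
    intro p
    rw [Fintype.card_piFinset, ← mul_prod_erase univ _ (mem_univ i), ← mul_prod_erase _ _ hji]
    simp only [if_true, card_singleton, one_mul, if_neg hij.symm]
    refine prod_congr rfl fun l hl => ?_
    rw [if_neg (ne_of_mem_erase (mem_of_mem_erase hl)), if_neg (ne_of_mem_erase hl)]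
  have hsub : (badPairs ρ S c i j).biUnion F ⊆ killedAt ρ S c i j := by
    intro t ht
    obtain ⟨p, hp, ht⟩ := mem_biUnion.1 ht
    obtain ⟨h1, h2⟩ := hF p t ht
    rw [badPairs, mem_filter, mem_product] at hp
    refine mem_filter.2 ⟨Fintype.mem_piFinset.2 fun m => ?_, by rw [h1, h2]; exact hp.2⟩
    have h := Fintype.mem_piFinset.1 ht m
    split_ifs at h with hi hj
    · rw [hi, h1]; exact hp.1.1
    · rw [hj, h2]; exact hp.1.2
    · exact h
  refine le_trans (le_of_eq ?_) (card_le_card hsub)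
  rw [card_biUnion, sum_congr rfl fun p _ => hcard p, sum_const, smul_eq_mul]
  intro p _ q _ hpq
  rw [Function.onFun, disjoint_left]
  intro t hp hq
  exact hpq (Prod.ext ((hF p t hp).1.symm.trans (hF q t hq).1)
    ((hF p t hp).2.symm.trans (hF q t hq).2))

/-- If the pairs `(a, b)` and `(a', b')` cover all classes, a transversal is determined by its
restrictions to them. -/
theorem card_killedAt_inter_le {a b a' b' : Fin k}
    (h : ∀ m, m = a ∨ m = b ∨ m = a' ∨ m = b') :
    (killedAt ρ S c a b ∩ killedAt ρ S c a' b').card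
      ≤ (badPairs ρ S c a b).card * (badPairs ρ S c a' b').card := by
  rw [← card_product]
  refine card_le_card_of_injOn (fun t => ((t a, t b), (t a', t b'))) (fun t ht => ?_) ?_
  · rw [mem_coe, mem_inter, killedAt, killedAt, mem_filter, mem_filter,
      Fintype.mem_piFinset] at ht
    rw [mem_coe, mem_product, badPairs, badPairs, mem_filter, mem_filter, mem_product, mem_product]
    exact ⟨⟨⟨ht.1.1 a, ht.1.1 b⟩, ht.1.2⟩, ⟨ht.1.1 a', ht.1.1 b'⟩, ht.2.2⟩
  · intro t _ t' _ htt
    simp only [Prod.mk.injEq] at htt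
    funext m
    rcases h m with rfl | rfl | rfl | rfl
    exacts [htt.1.1, htt.1.2, htt.2.1, htt.2.2]

/-- A transversal copy contains no bad pair. -/
theorem card_transversal_add_card_killed_le :
    ((copies ρ S).filter fun φ => ∀ i, c (φ i) = i).card + (killed ρ S c).card
      ≤ ∏ i, (part S c i).card := by
  rw [← Fintype.card_piFinset, ← card_union_of_disjoint]
  · refine card_le_card (union_subset (fun φ hφ => ?_) (filter_subset _ _))
    rw [mem_filter, mem_copies] at hφ
    exact Fintype.mem_piFinset.2 fun i => mem_part.2 ⟨hφ.1.1 i, hφ.2 i⟩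
  · rw [disjoint_left]
    intro φ hφ hφ'
    rw [mem_filter, mem_copies] at hφ
    obtain ⟨i, j, hne, hbad⟩ := (mem_filter.1 hφ').2
    have hij : i ≠ j := fun h => hne (by rw [h])
    exact hbad ⟨by rw [hφ.1.2 i j hij, hφ.2 i], by rw [hφ.1.2 j i hij.symm, hφ.2 j]⟩

theorem card_copies_le_transversal_add_bad :
    (copies ρ S).card ≤ ((copies ρ S).filter fun φ => ∀ i, c (φ i) = i).card
      + ((copies ρ S).filter fun φ => ∃ i, c (φ i) ≠ i).card := by
  rw [← card_filter_add_card_filter_not (s := copies ρ S) fun φ => ∀ i, c (φ i) = i]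
  simp only [not_forall, ne_eq, le_refl]

theorem card_copies_le_transversal_add_inside_add_stray (hk : 0 < k) :
    (copies ρ S).card ≤ ((copies ρ S).filter fun φ => ∀ i, c (φ i) = i).card
      + ∑ i, (copies ρ (part S c i)).card + (strayCopies ρ S c).card := by
  have h : copies ρ S ⊆ (((copies ρ S).filter fun φ => ∀ i, c (φ i) = i) ∪
      univ.biUnion fun i => copies ρ (part S c i)) ∪ strayCopies ρ S c := by
    intro φ hφ
    simp only [mem_union, mem_biUnion, strayCopies, mem_filter, mem_univ, true_and]
    by_cases h1 : ∀ i, c (φ i) = i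
    · exact Or.inl (Or.inl ⟨hφ, h1⟩)
    by_cases h2 : ∃ i j, c (φ i) ≠ c (φ j)
    · exact Or.inr ⟨hφ, not_forall.1 h1, h2⟩
    · push Not at h2
      refine Or.inl (Or.inr ⟨c (φ ⟨0, hk⟩), ?_⟩)
      rw [mem_copies] at hφ ⊢
      exact ⟨fun i => mem_part.2 ⟨hφ.1 i, h2 _ _⟩, hφ.2⟩
  refine (card_le_card h).trans ((card_union_le _ _).trans ?_)
  gcongr
  refine (card_union_le _ _).trans ?_
  gcongr
  exact card_biUnion_le

end

/-! ### Destroyed transversals outnumber stray copies -/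

theorem add_one_mul_pow_le {K : ℕ} (hK : 4 ≤ K) :
    ((K : ℝ) + 1) * (21 / 20) ^ K ≤ 3 / 80 * (K : ℝ) ^ K := by
  induction K, hK using Nat.le_induction with
  | base => norm_num
  | succ K hK ih =>
    have hKr : (4 : ℝ) ≤ K := by exact_mod_cast hK
    have h1 : (K : ℝ) ^ K ≤ (K + 1) ^ K := pow_le_pow_left₀ (by linarith) (by linarith) K
    have h0 : (0 : ℝ) ≤ (21 / 20) ^ K := by positivity
    have h2 : (0 : ℝ) ≤ (K : ℝ) ^ K := by positivity
    push_cast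
    rw [pow_succ, pow_succ]
    calc ((K : ℝ) + 1 + 1) * ((21 / 20) ^ K * (21 / 20))
        ≤ 2 * (((K : ℝ) + 1) * (21 / 20) ^ K) := by nlinarith
      _ ≤ 2 * (3 / 80 * (K : ℝ) ^ K) := by linarith
      _ ≤ 3 / 80 * ((K + 1) ^ K * (K + 1)) := by nlinarith

theorem mul_mul_pow_le {M : ℕ} (hM : 3 ≤ M) :
    ((M : ℝ) + 2) * (M + 1) * (21 / 20) ^ M * (47 / 20) ^ 2 ≤ 9 / 5 * (M : ℝ) ^ (M + 1) := by
  induction M, hM using Nat.le_induction with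
  | base => norm_num
  | succ M hM ih =>
    have hMr : (3 : ℝ) ≤ M := by exact_mod_cast hM
    have h1 : (M : ℝ) ^ (M + 1) ≤ (M + 1) ^ (M + 1) :=
      pow_le_pow_left₀ (by linarith) (by linarith) _
    have h2 : (0 : ℝ) ≤ (M : ℝ) ^ (M + 1) := by positivity
    have h3 : ((M : ℝ) + 1 + 2) * 21 / 20 ≤ 2 * (M + 1) := by linarith
    push_cast
    rw [pow_succ (21 / 20 : ℝ), pow_succ ((M : ℝ) + 1) (M + 1)]
    calc ((M : ℝ) + 1 + 2) * (M + 1 + 1) * ((21 / 20) ^ M * (21 / 20)) * (47 / 20) ^ 2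
        = ((M : ℝ) + 1 + 2) * 21 / 20 * ((M + 2) * (21 / 20) ^ M * (47 / 20) ^ 2) := by ring
      _ ≤ 2 * ((M : ℝ) + 1) * ((M + 2) * (21 / 20) ^ M * (47 / 20) ^ 2) := by gcongr
      _ = 2 * (((M : ℝ) + 2) * (M + 1) * (21 / 20) ^ M * (47 / 20) ^ 2) := by ring
      _ ≤ 2 * (9 / 5 * (M : ℝ) ^ (M + 1)) := by linarith
      _ ≤ 9 / 5 * ((M + 1) ^ (M + 1) * (M + 1)) := by nlinarith

/-- Here `v i` are the sizes of the classes, `C i j` the numbers of bad pairs, `K` the number of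
destroyed transversals and `B` the number of stray copies, in a set of `k * N` vertices. Each
`C i j` separately gives a lower bound for `K`, and averaging these bounds suffices. -/
theorem stray_le_killed_of_five_le {k : ℕ} (hk : 5 ≤ k) {N D : ℝ} {v : Fin k → ℕ}
    {C : Fin k → Fin k → ℕ} {K B : ℕ} (hN : (k : ℝ) - 1 ≤ N) (hD0 : 0 ≤ D)
    (hD : D ≤ 21 / 20 * (N - 1 / k)) (hv : ∀ i, (v i : ℝ) ≤ 2 * D + 1)
    (hP : 15 / 16 * N ^ k - k * N * (D / (k - 1 : ℕ)) ^ (k - 1) ≤ ∏ i, (v i : ℝ))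
    (hK : ∀ i j, i ≠ j → C i j * ∏ m ∈ (univ.erase i).erase j, v m ≤ K)
    (hB : 2 * (k - 2 : ℕ) * (B : ℝ)
      ≤ (∑ i, ∑ j ∈ univ.erase i, (C i j : ℝ)) * (D / (k - 2 : ℕ)) ^ (k - 2)) :
    0 < ∏ i, v i ∧ B ≤ K := by
  obtain ⟨M, rfl⟩ : ∃ M, k = M + 2 := ⟨k - 2, by omega⟩
  have hM : 3 ≤ M := by omega
  have hMr : (3 : ℝ) ≤ M := by exact_mod_cast hM
  simp only [show M + 2 - 1 = M + 1 from rfl, Nat.add_sub_cancel] at *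
  push_cast at hN hD hP
  have hN4 : (4 : ℝ) ≤ N := by linarith
  have hN0 : 0 < N := by linarith
  have hDN : D ≤ 21 / 20 * N := by
    have : (0 : ℝ) ≤ 1 / (M + 2) := by positivity
    linarith
  have hvN : ∀ i, (v i : ℝ) ≤ 47 / 20 * N := fun i => by have := hv i; linarith
  have hP' : 9 / 10 * N ^ (M + 2) ≤ ∏ i, (v i : ℝ) := by
    refine le_trans ?_ hP
    have h1 := add_one_mul_pow_le (K := M + 1) (by omega)
    push_cast at h1
    have h2 : (0 : ℝ) < ((M : ℝ) + 1) ^ (M + 1) := by positivity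
    have h3 : ((M : ℝ) + 2) * N * (D / (M + 1)) ^ (M + 1) ≤ 3 / 80 * N ^ (M + 2) := by
      calc ((M : ℝ) + 2) * N * (D / (M + 1)) ^ (M + 1)
          ≤ ((M : ℝ) + 2) * N * (21 / 20 * N / (M + 1)) ^ (M + 1) := by gcongr
        _ = (((M : ℝ) + 1 + 1) * (21 / 20) ^ (M + 1)) / (M + 1) ^ (M + 1) * N ^ (M + 2) := by
            rw [div_pow, mul_pow]; ring
        _ ≤ 3 / 80 * N ^ (M + 2) := by
            refine mul_le_mul_of_nonneg_right ?_ (by positivity)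
            rw [div_le_iff₀ h2]; exact h1
    linarith
  have hpos : (0 : ℝ) < ∏ i, (v i : ℝ) := lt_of_lt_of_le (by positivity) hP'
  refine ⟨by exact_mod_cast hpos, ?_⟩
  have hpair : ∀ i j, i ≠ j → (C i j : ℝ) * (9 / 10 * N ^ M) ≤ (47 / 20) ^ 2 * K := by
    intro i j hij
    have hji : j ∈ univ.erase i := mem_erase.2 ⟨hij.symm, mem_univ _⟩
    have h1 : (C i j : ℝ) * ∏ m ∈ (univ.erase i).erase j, (v m : ℝ) ≤ K := by
      exact_mod_cast hK i j hij
    have h2 : ∏ i, (v i : ℝ) = v i * (v j * ∏ m ∈ (univ.erase i).erase j, (v m : ℝ)) := by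
      rw [mul_prod_erase _ (fun m => (v m : ℝ)) hji,
        mul_prod_erase _ (fun m => (v m : ℝ)) (mem_univ i)]
    set R := ∏ m ∈ (univ.erase i).erase j, (v m : ℝ) with hR
    have hR0 : 0 ≤ R := by positivity
    have h3 : (v i : ℝ) * (v j * R) ≤ (47 / 20) ^ 2 * N ^ 2 * R := by
      have := mul_le_mul (hvN i) (hvN j) (Nat.cast_nonneg _) (by positivity)
      calc (v i : ℝ) * (v j * R) = v i * v j * R := by ring
        _ ≤ 47 / 20 * N * (47 / 20 * N) * R := by gcongr
        _ = _ := by ring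
    have h4 : 9 / 10 * N ^ M ≤ (47 / 20) ^ 2 * R := by
      have h5 : 9 / 10 * N ^ M * N ^ 2 ≤ (47 / 20) ^ 2 * R * N ^ 2 := by
        calc 9 / 10 * N ^ M * N ^ 2 = 9 / 10 * N ^ (M + 2) := by ring
          _ ≤ _ := hP'.trans (h2.le.trans (h3.trans_eq (by ring)))
      exact le_of_mul_le_mul_right h5 (by positivity)
    calc (C i j : ℝ) * (9 / 10 * N ^ M) ≤ C i j * ((47 / 20) ^ 2 * R) := by gcongr
      _ = (47 / 20) ^ 2 * (C i j * R) := by ring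
      _ ≤ _ := by gcongr
  set W := ∑ i, ∑ j ∈ univ.erase i, (C i j : ℝ) with hW
  have hW0 : 0 ≤ W := by positivity
  have hsum : W * (9 / 10 * N ^ M) ≤ (M + 2) * (M + 1) * ((47 / 20) ^ 2 * K) := by
    rw [hW, sum_mul]
    have : ∀ i ∈ (univ : Finset (Fin (M + 2))), (∑ j ∈ univ.erase i, (C i j : ℝ)) * (9 / 10 * N ^ M)
        ≤ (M + 1) * ((47 / 20) ^ 2 * K) := by
      intro i _
      rw [sum_mul]
      refine (sum_le_card_nsmul _ _ _ fun j hj => hpair i j (ne_of_mem_erase hj).symm).trans_eq ?_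
      rw [card_erase_of_mem (mem_univ _), card_univ, Fintype.card_fin, nsmul_eq_mul]
      push_cast [show M + 2 - 1 = M + 1 from rfl]
      ring
    refine (sum_le_card_nsmul _ _ _ this).trans_eq ?_
    rw [card_univ, Fintype.card_fin, nsmul_eq_mul]
    push_cast
    ring
  have hMM := mul_mul_pow_le hM
  have hM0 : (0 : ℝ) < M := by linarith
  -- combine: `2 M^(M+1) B ≤ W (1.05 N)^M` and the bound on `W`
  have h1 : 2 * (M : ℝ) * B * M ^ M ≤ W * ((21 / 20) ^ M * N ^ M) := by
    calc 2 * (M : ℝ) * B * M ^ M ≤ W * (D / M) ^ M * M ^ M := by gcongr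
      _ = W * D ^ M := by rw [div_pow]; field_simp
      _ ≤ W * (21 / 20 * N) ^ M := by gcongr
      _ = _ := by rw [mul_pow]
  have h2 : 9 / 5 * (M : ℝ) ^ (M + 1) * B ≤ 9 / 5 * (M : ℝ) ^ (M + 1) * K := by
    calc 9 / 5 * (M : ℝ) ^ (M + 1) * B = 9 / 10 * (2 * (M : ℝ) * B * M ^ M) := by ring
      _ ≤ 9 / 10 * (W * ((21 / 20) ^ M * N ^ M)) := by gcongr
      _ = W * (9 / 10 * N ^ M) * (21 / 20) ^ M := by ring
      _ ≤ (M + 2) * (M + 1) * ((47 / 20) ^ 2 * K) * (21 / 20) ^ M := by gcongr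
      _ = (((M : ℝ) + 2) * (M + 1) * (21 / 20) ^ M * (47 / 20) ^ 2) * K := by ring
      _ ≤ _ := by gcongr
  exact_mod_cast le_of_mul_le_mul_left h2 (by positivity)

/-- Two sums `a + b` and `a' + b'` with total `4 N` whose parts multiply to almost `N ^ 4` are
nearly equal. -/
theorem le_mul_of_prod_four {N a b a' b' : ℝ} (hN : 0 < N) (ha : 0 ≤ a) (hb : 0 ≤ b) (ha' : 0 ≤ a')
    (hb' : 0 ≤ b') (hs : a + b + (a' + b') = 4 * N)
    (hp : 81 / 100 * N ^ 4 ≤ a * b * (a' * b')) : 4675 / 10000 * N ^ 2 ≤ a * b := by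
  set τ := a' + b' with hτ
  have hτ0 : 0 ≤ τ := by positivity
  have h1 : a * b ≤ (4 * N - τ) ^ 2 / 4 := by
    have : 4 * N - τ = a + b := by linarith
    rw [this]; nlinarith [sq_nonneg (a - b)]
  have h2 : a' * b' ≤ τ ^ 2 / 4 := by rw [hτ]; nlinarith [sq_nonneg (a' - b')]
  have hab : 0 ≤ a * b := by positivity
  have h3 : (36 / 10 * N ^ 2) ^ 2 ≤ (τ * (4 * N - τ)) ^ 2 := by
    have := mul_le_mul h1 h2 (by positivity) (by positivity)
    nlinarith
  have h4 : 36 / 10 * N ^ 2 ≤ τ * (4 * N - τ) :=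
    le_of_sq_le_sq h3 (mul_nonneg hτ0 (by linarith))
  -- the larger root of `τ (4 - τ) = 3.6` is `2 + √0.4 < 2.6325`
  have h5 : τ ≤ 26325 / 10000 * N := by
    by_contra! h
    nlinarith [mul_pos hN hN]
  have h6 : a' * b' ≤ 17326 / 10000 * N ^ 2 := by
    have : τ ^ 2 ≤ (26325 / 10000 * N) ^ 2 := by gcongr
    nlinarith [mul_pos hN hN]
  have h7 : 4675 / 10000 * N ^ 2 * (17326 / 10000 * N ^ 2)
      ≤ a * b * (17326 / 10000 * N ^ 2) := by
    have : a * b * (a' * b') ≤ a * b * (17326 / 10000 * N ^ 2) := by gcongr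
    have h8 : 0 ≤ N ^ 4 := by positivity
    nlinarith
  exact le_of_mul_le_mul_right h7 (by positivity)

/-- If the events of density `x / X` and `y / Y` are independent and their union is small, then the
size of their union is nearly the sum of their sizes. -/
theorem mul_add_mul_le_of_union {x y X Y K : ℝ} (hx : 0 ≤ x) (hy : 0 ≤ y) (hxX : x ≤ X)
    (hyY : y ≤ Y) (hX : 0 < X) (hY : 0 < Y) (hK : x * Y + y * X - x * y ≤ K)
    (hs : K ≤ 2118 / 10000 * (X * Y)) : 8941 / 10000 * (x * Y + y * X) ≤ K := by
  have h1 : x ≤ 2118 / 10000 * X := by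
    have h : x * Y ≤ 2118 / 10000 * X * Y := by nlinarith
    exact le_of_mul_le_mul_right h hY
  have h2 : y ≤ 2118 / 10000 * Y := by
    have h : y * X ≤ 2118 / 10000 * Y * X := by nlinarith
    exact le_of_mul_le_mul_right h hX
  nlinarith [mul_le_mul_of_nonneg_left h2 hx, mul_le_mul_of_nonneg_left h1 hy]

/-- The notation is that of `stray_le_killed_of_five_le`. The bounds from single `C i j` are
too weak here, but for a perfect matching of the four classes the destroyed transversals of both
pairs nearly add up, because few transversals are destroyed altogether. -/
theorem stray_le_killed_of_four {N D : ℝ} {v : Fin 4 → ℕ}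
    {C : Fin 4 → Fin 4 → ℕ} {K B : ℕ} (hN : 13 / 4 ≤ N) (hD0 : 0 ≤ D)
    (hD : D ≤ 21 / 20 * (N - 1 / 4)) (hv : ∑ i, (v i : ℝ) = 4 * N)
    (hP : N ^ 4 - N ^ 2 / 2 - 4 * N * (D / 3) ^ 3 ≤ ∏ i, (v i : ℝ))
    (hKs : (K : ℝ) ≤ 4 * N * (D / 3) ^ 3)
    (hC : ∀ i j, C i j ≤ v i * v j)
    (hK : ∀ a b a' b', (∀ m, m = a ∨ m = b ∨ m = a' ∨ m = b') →
      C a b * (v a' * v b') + C a' b' * (v a * v b) ≤ K + C a b * C a' b')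
    (hB : 4 * (B : ℝ) ≤ (∑ i, ∑ j ∈ univ.erase i, (C i j : ℝ)) * (D / 2) ^ 2) :
    0 < ∏ i, v i ∧ B ≤ K := by
  have hN0 : 0 < N := by linarith
  have hbad : 4 * N * (D / 3) ^ 3 ≤ 1715 / 10000 * (N * (N - 1 / 4) ^ 3) := by
    calc 4 * N * (D / 3) ^ 3 ≤ 4 * N * (21 / 20 * (N - 1 / 4) / 3) ^ 3 := by gcongr
      _ = _ := by ring
  have hbad4 : 1715 / 10000 * (N * (N - 1 / 4) ^ 3) ≤ 1715 / 10000 * N ^ 4 := by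
    have : (N - 1 / 4) ^ 3 ≤ N ^ 3 := pow_le_pow_left₀ (by linarith) (by linarith) 3
    calc _ ≤ 1715 / 10000 * (N * N ^ 3) := by gcongr
      _ = _ := by ring
  have hP' : 81 / 100 * N ^ 4 ≤ ∏ i, (v i : ℝ) := by
    refine le_trans ?_ hP
    have h : 0 ≤ 19 / 100 * N ^ 3 - N / 2 - 1715 / 10000 * (N - 1 / 4) ^ 3 := by
      obtain ⟨u, rfl⟩ : ∃ u, N = 13 / 4 + u := ⟨N - 13 / 4, by ring⟩
      have hu : 0 ≤ u := by linarith
      have h2 : 0 ≤ u ^ 2 := by positivity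
      have h3 : 0 ≤ u ^ 3 := by positivity
      ring_nf
      nlinarith
    nlinarith [mul_nonneg hN0.le h]
  have hpos : (0 : ℝ) < ∏ i, (v i : ℝ) := lt_of_lt_of_le (by positivity) hP'
  refine ⟨by exact_mod_cast hpos, ?_⟩
  rw [Fin.prod_univ_four] at hP'
  rw [Fin.sum_univ_four] at hv
  have hN4 : 0 < N ^ 4 := by positivity
  have hpair : ∀ a b a' b' : Fin 4, (∀ m, m = a ∨ m = b ∨ m = a' ∨ m = b') →
      (v a : ℝ) + v b + (v a' + v b') = 4 * N →
      81 / 100 * N ^ 4 ≤ (v a : ℝ) * v b * (v a' * v b') →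
      8941 / 10000 * (4675 / 10000 * N ^ 2) * ((C a b : ℝ) + C a' b') ≤ K := by
    intro a b a' b' hm hs hp
    have h1 := le_mul_of_prod_four hN0 (Nat.cast_nonneg _) (Nat.cast_nonneg _) (Nat.cast_nonneg _)
      (Nat.cast_nonneg _) hs hp
    have h2 := le_mul_of_prod_four hN0 (Nat.cast_nonneg _) (Nat.cast_nonneg _) (Nat.cast_nonneg _)
      (Nat.cast_nonneg _) ((add_comm _ _).trans hs) (hp.trans_eq (mul_comm _ _))
    have h3 : (C a b : ℝ) * (v a' * v b') + C a' b' * (v a * v b) ≤ K + C a b * C a' b' := by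
      exact_mod_cast hK a b a' b' hm
    -- `K ≤ 0.1715 N ^ 4` and `∏ i, v i ≥ 0.81 N ^ 4`, with ratio less than `0.2118`
    have h4 := mul_add_mul_le_of_union (x := C a b) (y := C a' b') (X := v a * v b)
      (Y := v a' * v b') (K := K) (Nat.cast_nonneg _) (Nat.cast_nonneg _)
      (by exact_mod_cast hC a b) (by exact_mod_cast hC a' b') (lt_of_lt_of_le (by positivity) h1)
      (lt_of_lt_of_le (by positivity) h2) (by linarith) (by linarith)
    refine le_trans ?_ h4
    have h5 := mul_le_mul_of_nonneg_left h2 (Nat.cast_nonneg (α := ℝ) (C a b))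
    have h6 := mul_le_mul_of_nonneg_left h1 (Nat.cast_nonneg (α := ℝ) (C a' b'))
    linarith
  have e1 := hpair 0 1 2 3 (by decide) (by linarith) (by linarith)
  have e2 := hpair 1 0 3 2 (by decide) (by linarith) (by linarith)
  have e3 := hpair 0 2 1 3 (by decide) (by linarith) (by linarith)
  have e4 := hpair 2 0 3 1 (by decide) (by linarith) (by linarith)
  have e5 := hpair 0 3 1 2 (by decide) (by linarith) (by linarith)
  have e6 := hpair 3 0 2 1 (by decide) (by linarith) (by linarith)
  set W := ∑ i, ∑ j ∈ univ.erase i, (C i j : ℝ) with hW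
  have hWe : W = (C 0 1 + C 0 2 + C 0 3 + (C 1 0 + C 1 2 + C 1 3) + (C 2 0 + C 2 1 + C 2 3)
      + (C 3 0 + C 3 1 + C 3 2) : ℝ) := by
    rw [hW, Fin.sum_univ_four, show (univ : Finset (Fin 4)).erase 0 = {1, 2, 3} by decide,
      show (univ : Finset (Fin 4)).erase 1 = {0, 2, 3} by decide,
      show (univ : Finset (Fin 4)).erase 2 = {0, 1, 3} by decide,
      show (univ : Finset (Fin 4)).erase 3 = {0, 1, 2} by decide]
    simp [← add_assoc]
  have hW0 : 0 ≤ W := by positivity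
  have h6K : 8941 / 10000 * (4675 / 10000 * N ^ 2) * W ≤ 6 * K := by
    rw [hWe]; linarith
  have h7 : W * (D / 2) ^ 2 ≤ W * (11025 / 40000 * N ^ 2) := by
    have : (D / 2) ^ 2 ≤ (21 / 20 * N / 2) ^ 2 := by gcongr; linarith
    have h8 : (21 / 20 * N / 2) ^ 2 = 11025 / 40000 * N ^ 2 := by ring
    rw [← h8]
    gcongr
  have h8 : 0 ≤ W * N ^ 2 := by positivity
  have h9 : (B : ℝ) ≤ K := by linarith
  exact_mod_cast h9

/-! ### The number of copies is at most `g` -/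

/-- Sharp bound for the number of copies of the pattern in a set of given size. -/
theorem card_copies_le_g {k : ℕ} {V : Type*} [DecidableEq V] (hk : 4 ≤ k) (ρ : V → V → Fin k)
    (S : Finset V) : (copies ρ S).card ≤ g k S.card := by
  induction hn : S.card using Nat.strong_induction_on generalizing S with
  | _ n ih =>
  subst hn
  have ih' : ∀ T : Finset V, T.card < S.card → (copies ρ T).card ≤ g k T.card :=
    fun T hT => ih _ hT T rfl
  have her : ∀ x ∈ S, (copies ρ (S.erase x)).card ≤ g k (S.card - 1) := by
    intro x hx
    rw [← card_erase_of_mem hx]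
    exact ih' _ (card_erase_lt_of_mem hx)
  rcases le_or_gt S.card (k * (k - 1)) with hsmall | hlarge
  · exact card_copies_le_g_of_small (by omega) hsmall her
  by_contra! hbig
  set n := S.card with hn
  obtain ⟨ν, hν⟩ : ∃ ν, n = ν + 1 := ⟨n - 1, by omega⟩
  have hkν : k * (k - 1) ≤ ν := by omega
  have hk0 : (0 : ℝ) < k := by exact_mod_cast (by omega : 0 < k)
  set D : ℝ := 21 / 20 * ((ν : ℝ) / k) with hD
  set N : ℝ := (n : ℝ) / k with hN
  have hnN : (n : ℝ) = k * N := by rw [hN]; field_simp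
  have hD0 : 0 ≤ D := by positivity
  have hDN : D = 21 / 20 * (N - 1 / k) := by
    rw [hD, hN, hν]; push_cast; ring
  have hrole : ∀ x, ∃ i, x ∈ S →
      (ν : ℝ) - (∑ j ∈ univ.erase i, (nbr ρ S x i j).card : ℕ) ≤ D := by
    intro x
    by_cases hx : x ∈ S
    · have h1 : ∑ i, ∑ j ∈ univ.erase i, (nbr ρ S x i j).card ≤ ν := by
        have h := sum_card_outNbr (ρ := ρ) hx
        have h' := sum_le_sum fun i (_ : i ∈ (univ : Finset (Fin k))) =>
          sum_card_nbr_le (ρ := ρ) (S := S) (univ.erase i) x i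
        omega
      have h2 := mul_g_add_le_mul_degree (ρ := ρ) (S := S) (x := x) (ν := ν) (by omega)
        (by rw [← hν]; exact hbig) (by have := her x hx; rwa [hν] at this)
      obtain ⟨i, hi⟩ := exists_dominant_role hk hkν (fun i j => (nbr ρ S x i j).card) h1 h2
      exact ⟨i, fun _ => hi⟩
    · exact ⟨⟨0, by omega⟩, fun h => absurd h hx⟩
  choose c hc using hrole
  have haway : ∀ x ∈ S, ((away ρ S c x).card : ℝ) ≤ D := by
    intro x hx
    have h1 := card_away_add (ρ := ρ) (c := c) hx
    have h2 := hc x hx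
    have h3 : ((away ρ S c x).card : ℝ)
        + (∑ j ∈ univ.erase (c x), (nbr ρ S x (c x) j).card : ℕ) = ν := by
      exact_mod_cast (by omega : (away ρ S c x).card
        + ∑ j ∈ univ.erase (c x), (nbr ρ S x (c x) j).card = ν)
    linarith
  set v : Fin k → ℕ := fun i => (part S c i).card with hv
  have hvsum : ∑ i, v i = n := sum_card_parts S c
  have hvg : ∏ i, v i ≤ g k n := prod_card_parts_le_g (by omega) S c
  have hTK := card_transversal_add_card_killed_le (ρ := ρ) (S := S) (c := c)
  have hbad := card_copies_bad_le (c := c) (by omega) haway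
  have hdec := card_copies_le_transversal_add_bad (ρ := ρ) (S := S) (c := c)
  set T := ((copies ρ S).filter fun φ => ∀ i, c (φ i) = i).card with hT
  set bad := ((copies ρ S).filter fun φ => ∃ i, c (φ i) ≠ i).card with hbad_def
  have hTK' : T + (killed ρ S c).card ≤ ∏ i, v i := hTK
  -- since there are more than `g k n` copies, few transversals are destroyed and the partition
  -- is nearly balanced
  have hKbad : (killed ρ S c).card ≤ bad := by omega
  have hPbad : g k n ≤ ∏ i, v i + bad := by omega
  rw [← hn, hnN] at hbad
  have hB := card_strayCopies_le (c := c) (by omega : 3 ≤ k) haway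
  obtain ⟨hPpos, hBK⟩ : 0 < ∏ i, v i ∧ (strayCopies ρ S c).card ≤ (killed ρ S c).card := by
    have hPr : (g k n : ℝ) - k * N * (D / (k - 1 : ℕ)) ^ (k - 1) ≤ ∏ i, (v i : ℝ) := by
      have : (g k n : ℝ) ≤ ∏ i, (v i : ℝ) + bad := by exact_mod_cast hPbad
      linarith
    have hKat : ∀ i j, (killedAt ρ S c i j).card ≤ (killed ρ S c).card :=
      fun i j => card_le_card (killedAt_subset i j)
    rcases hk.eq_or_lt with h4 | h5
    · subst h4
      have hn13 : 13 ≤ n := by omega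
      have hn13r : (13 : ℝ) ≤ n := by exact_mod_cast hn13
      have hg4 := pow_four_sub_le_g (n := n) (by omega)
      have h4N : (n : ℝ) / 4 = N := by rw [hN]; norm_num
      rw [h4N] at hg4
      push_cast at hPr hbad hDN
      norm_num at hPr hbad hDN
      refine stray_le_killed_of_four (N := N) (D := D) (v := v)
        (C := fun i j => (badPairs ρ S c i j).card) ?_ hD0 ?_ ?_ ?_ ?_ ?_ ?_ ?_
      · rw [← h4N]; linarith
      · rw [hDN]
      · rw [← h4N]
        have : (∑ i, (v i : ℝ)) = n := by exact_mod_cast hvsum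
        rw [this]; ring
      · linarith
      · exact le_trans (by exact_mod_cast hKbad) hbad
      · intro i j
        rw [← card_product]
        exact card_le_card (filter_subset _ _)
      · intro a b a' b' h
        have hne : a ≠ b ∧ a' ≠ b' ∧ a ≠ a' ∧ a ≠ b' ∧ b ≠ a' ∧ b ≠ b' := by
          revert a b a' b'; decide
        obtain ⟨n1, n2, n3, n4, n5, n6⟩ := hne
        have e1 : ((univ : Finset (Fin 4)).erase a).erase b = {a', b'} := by
          ext m; have := h m; simp only [mem_erase, mem_univ, mem_insert, mem_singleton]; grind
        have e2 : ((univ : Finset (Fin 4)).erase a').erase b' = {a, b} := by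
          ext m; have := h m; simp only [mem_erase, mem_univ, mem_insert, mem_singleton]; grind
        have h1 := card_badPairs_mul_le (ρ := ρ) (S := S) (c := c) n1
        have h2 := card_badPairs_mul_le (ρ := ρ) (S := S) (c := c) n2
        rw [e1, prod_pair n2] at h1
        rw [e2, prod_pair n1] at h2
        have h3 := card_killedAt_inter_le (ρ := ρ) (S := S) (c := c) h
        have h4 := card_union_add_card_inter (killedAt ρ S c a b) (killedAt ρ S c a' b')
        have h5 := card_le_card (union_subset (killedAt_subset (ρ := ρ) (S := S) (c := c) a b)
          (killedAt_subset a' b'))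
        simp only [hv]
        omega
      · exact le_trans (le_of_eq (by norm_num)) (hB.trans_eq (by norm_num))
    · refine stray_le_killed_of_five_le (N := N) (D := D) (v := v)
        (C := fun i j => (badPairs ρ S c i j).card) h5 ?_ hD0 hDN.le
        (fun i => card_part_le haway i hD0) ?_ ?_ hB
      · rw [hN, le_div_iff₀ hk0]
        have : (k : ℝ) * ((k - 1 : ℕ) : ℝ) ≤ n := by exact_mod_cast hlarge.le
        rw [Nat.cast_sub (by omega)] at this
        push_cast at this
        linarith
      · have := fifteen_sixteenths_mul_pow_le_g hk hlarge.le
        rw [← hN] at this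
        linarith
      · exact fun i j hij => (card_badPairs_mul_le hij).trans (hKat i j)
  have hlt : ∀ i, v i < n := by
    intro i
    obtain ⟨j, hj, -⟩ := exists_ne_ne (by omega : 3 ≤ k) i i
    have h1 := add_le_sum (f := v) (fun _ _ => Nat.zero_le _) (mem_univ i) (mem_univ j) hj.symm
    have h2 : v j ≠ 0 := fun h => hPpos.ne' (prod_eq_zero (mem_univ j) h)
    omega
  have hfin := sum_g_add_prod_le_g
    ((Nat.le_mul_of_pos_right k (by omega)).trans hlarge.le : k ≤ n) v hlt hvsum
  have hin : ∑ i, (copies ρ (part S c i)).card ≤ ∑ i, g k (v i) :=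
    sum_le_sum fun i _ => ih' _ (hlt i)
  have := card_copies_le_transversal_add_inside_add_stray (ρ := ρ) (S := S) (c := c) (by omega)
  omega

/-! ### A random role assignment has copies in all sets of logarithmic size -/

/-- Among the functions `X → Y`, the proportion of those that differ from `q` somewhere on each of
the disjoint sets `P b`, `b ∈ F`, is what independence predicts. -/
theorem card_forall_exists_ne_le {X Y ι : Type*} [Fintype X] [DecidableEq X] [Fintype Y]
    [DecidableEq Y] (q : X → Y) (P : ι → Finset X) (F : Finset ι) {w : ℕ}
    (hw : ∀ b ∈ F, (P b).card ≤ w) (hd : (F : Set ι).PairwiseDisjoint P) :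
    ((univ.filter fun f : X → Y => ∀ b ∈ F, ∃ x ∈ P b, f x ≠ q x).card : ℝ)
      ≤ (1 - ((Fintype.card Y : ℝ) ^ w)⁻¹) ^ F.card * (Fintype.card Y : ℝ) ^ Fintype.card X := by
  classical
  rcases isEmpty_or_nonempty X with hX | ⟨⟨x₀⟩⟩
  · rcases F.eq_empty_or_nonempty with rfl | ⟨b, hb⟩
    · simp
    · rw [filter_false_of_mem]
      · simp only [card_empty, Nat.cast_zero, Fintype.card_eq_zero, pow_zero, mul_one]
        refine pow_nonneg (sub_nonneg.2 ?_) _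
        rcases Nat.eq_zero_or_pos (Fintype.card Y) with h | h
        · rw [h]
          rcases Nat.eq_zero_or_pos w with rfl | hw0
          · simp
          · simp [hw0.ne']
        · exact inv_le_one_of_one_le₀ (one_le_pow₀ (by exact_mod_cast h))
      · intro f _ h
        obtain ⟨x, -⟩ := h b hb
        exact hX.elim x
  have hY : 0 < Fintype.card Y := Fintype.card_pos_iff.2 ⟨q x₀⟩
  have hy : (0 : ℝ) < (Fintype.card Y : ℝ) ^ w := by positivity
  induction F using Finset.induction_on with
  | empty => simp
  | insert b F hb ih =>
    have ih := ih (fun b' hb' => hw b' (mem_insert_of_mem hb'))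
      (hd.subset (by exact_mod_cast subset_insert b F))
    set G := univ.filter fun f : X → Y => ∀ b ∈ F, ∃ x ∈ P b, f x ≠ q x with hG
    set E := G.filter fun f => ∀ x ∈ P b, f x = q x with hE
    have hsplit : (univ.filter fun f : X → Y => ∀ b' ∈ insert b F, ∃ x ∈ P b', f x ≠ q x).card
        + E.card = G.card := by
      rw [add_comm, hE, ← card_filter_add_card_filter_not (s := G) fun f => ∀ x ∈ P b, f x = q x]
      congr 2
      ext f
      simp only [hG, mem_filter, mem_univ, true_and, mem_insert, forall_eq_or_imp, not_forall,
        ne_eq, exists_prop]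
      tauto
    -- overwriting `f` by `q` on `P b` maps `G` into `E`, with fibers of size at most `|Y| ^ w`
    have hGE : G.card ≤ E.card * Fintype.card Y ^ w := by
      have h1 : G.card ≤ (E ×ˢ (univ : Finset (P b → Y))).card := by
        refine card_le_card_of_injOn
          (fun f => (fun x => if x ∈ P b then q x else f x, fun x => f x)) (fun f hf => ?_) ?_
        · rw [mem_coe, hG, mem_filter] at hf
          rw [mem_coe, mem_product, hE, mem_filter, hG, mem_filter]
          refine ⟨⟨⟨mem_univ _, fun b' hb' => ?_⟩, fun x hx => if_pos hx⟩, mem_univ _⟩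
          obtain ⟨x, hx, hne⟩ := hf.2 b' hb'
          have hxb : x ∉ P b := disjoint_left.1 (hd (mem_insert_of_mem hb') (mem_insert_self _ _)
            fun h => hb (h ▸ hb')) hx
          exact ⟨x, hx, by simpa only [if_neg hxb] using hne⟩
        · intro f _ f' _ h
          rw [Prod.mk.injEq] at h
          funext x
          by_cases hx : x ∈ P b
          · exact congrFun h.2 ⟨x, hx⟩
          · simpa only [if_neg hx] using congrFun h.1 x
      rw [card_product, card_univ, Fintype.card_fun, Fintype.card_coe] at h1
      exact h1.trans (Nat.mul_le_mul_left _
        (Nat.pow_le_pow_right hY (hw b (mem_insert_self _ _))))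
    have h2 : (G.card : ℝ) * ((Fintype.card Y : ℝ) ^ w)⁻¹ ≤ E.card := by
      rw [← div_eq_mul_inv, div_le_iff₀ hy]
      exact_mod_cast hGE
    have h3 : (1 : ℝ) ≤ (Fintype.card Y : ℝ) ^ w := one_le_pow₀ (by exact_mod_cast hY)
    have h4 : 0 ≤ 1 - ((Fintype.card Y : ℝ) ^ w)⁻¹ := sub_nonneg.2 (inv_le_one_of_one_le₀ h3)
    rw [card_insert_of_notMem hb, pow_succ']
    calc _ = (G.card : ℝ) - E.card := by rw [← hsplit]; push_cast; ring
      _ ≤ (1 - ((Fintype.card Y : ℝ) ^ w)⁻¹) * G.card := by linarith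
      _ ≤ _ := by rw [mul_assoc]; gcongr

/-- Most role assignments have a copy in a given set of `k * (k * l)` vertices: arrange the
set in a `k × k l` grid and consider the `l ^ 2` lines `i ↦ (i, a + i b)`, no two of which share
two points. -/
theorem card_copies_eq_empty_le {k l : ℕ} {V : Type*} [Fintype V] [DecidableEq V] (hk : 0 < k)
    (hl : 0 < l) {A : Finset V} (hA : A.card = k * (k * l)) :
    ((univ.filter fun f : V × V → Fin k => copies (fun x y => f (x, y)) A = ∅).card : ℝ)
      ≤ (1 - ((k : ℝ) ^ (k * k))⁻¹) ^ (l * l) * (k : ℝ) ^ (Fintype.card (V × V)) := by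
  obtain ⟨e⟩ : Nonempty (Fin k × Fin (k * l) ≃ A) := by
    refine ⟨Fintype.equivOfCardEq ?_⟩
    rw [Fintype.card_prod, Fintype.card_fin, Fintype.card_fin, Fintype.card_coe, hA]
  obtain ⟨u, hu, huA⟩ : ∃ u : Fin k × Fin (k * l) → V, Function.Injective u ∧ ∀ p, u p ∈ A :=
    ⟨fun p => e p, Subtype.val_injective.comp e.injective, fun p => (e p).2⟩
  obtain ⟨q, hq⟩ : ∃ q : V × V → Fin k, ∀ p y, q (u p, y) = p.1 := by
    have : Nonempty (Fin k × Fin (k * l)) := ⟨(⟨0, hk⟩, ⟨0, by positivity⟩)⟩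
    exact ⟨fun xy => (Function.invFun u xy.1).1, fun p y =>
      congrArg Prod.fst (Function.leftInverse_invFun hu p)⟩
  have hlt : ∀ (b : Fin l × Fin l) (i : Fin k), (b.1 : ℕ) + i * b.2 < k * l := by
    intro b i
    have h1 := b.1.isLt
    have h2 : (i : ℕ) * b.2 ≤ (k - 1) * l :=
      Nat.mul_le_mul (by have := i.isLt; omega) b.2.isLt.le
    have h3 : (k - 1) * l + l = k * l := by
      rw [← Nat.succ_mul, Nat.succ_eq_add_one, Nat.sub_add_cancel hk]
    omega
  let pt : Fin l × Fin l → Fin k → V := fun b i => u (i, ⟨b.1 + i * b.2, hlt b i⟩)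
  have hpt : ∀ b b' i i', pt b i = pt b' i' →
      i = i' ∧ (b.1 : ℕ) + i * b.2 = b'.1 + i' * b'.2 := by
    intro b b' i i' h
    have h := hu h
    exact ⟨congrArg Prod.fst h, congrArg (fun p => (p.2 : ℕ)) h⟩
  let P : Fin l × Fin l → Finset (V × V) := fun b =>
    (univ : Finset (Fin k)).offDiag.image fun ij => (pt b ij.1, pt b ij.2)
  have hcardP : ∀ b ∈ (univ : Finset (Fin l × Fin l)), (P b).card ≤ k * k := by
    intro b _
    refine card_image_le.trans ?_
    rw [offDiag_card, card_univ, Fintype.card_fin]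
    omega
  have hdisj : ((univ : Finset (Fin l × Fin l)) : Set (Fin l × Fin l)).PairwiseDisjoint P := by
    rintro ⟨a, b⟩ _ ⟨a', b'⟩ _ hne
    rw [Function.onFun, disjoint_left]
    intro xy h h'
    simp only [P, mem_image, mem_offDiag, mem_univ, true_and, Prod.exists] at h h'
    obtain ⟨i, j, hij, rfl⟩ := h
    obtain ⟨i', j', hij', h'⟩ := h'
    rw [Prod.mk.injEq] at h'
    obtain ⟨hi, h1⟩ := hpt _ _ _ _ h'.1
    obtain ⟨hj, h2⟩ := hpt _ _ _ _ h'.2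
    subst hi hj
    simp only at h1 h2
    have hbb : (b : ℕ) = b' := by
      have hij'' : (i' : ℤ) - j' ≠ 0 := by
        have := Fin.val_ne_of_ne hij'
        omega
      zify at h1 h2 ⊢
      have : ((i' : ℤ) - j') * (b - b') = 0 := by linarith
      rcases mul_eq_zero.1 this with h | h
      · exact absurd h hij''
      · linarith
    have haa : (a : ℕ) = a' := by rw [hbb] at h1; omega
    exact hne (Prod.ext (Fin.ext haa) (Fin.ext hbb))
  have hmain := card_forall_exists_ne_le q P univ hcardP hdisj
  have hcard : (univ : Finset (Fin l × Fin l)).card = l * l := by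
    rw [card_univ, Fintype.card_prod, Fintype.card_fin]
  rw [hcard, Fintype.card_fin] at hmain
  refine le_trans ?_ hmain
  refine Nat.cast_le.2 (card_le_card fun f hf => ?_)
  have hf' := (mem_filter.1 hf).2
  suffices hs : ∀ b : Fin l × Fin l, ∃ x ∈ P b, f x ≠ q x by
    simpa using hs
  intro b
  by_contra! h
  have hcopy : pt b ∈ copies (fun x y => f (x, y)) A := by
    rw [mem_copies]
    refine ⟨fun i => huA _, fun i j hij => ?_⟩
    have hp := h (pt b i, pt b j) (mem_image.2 ⟨(i, j), by simp [hij], rfl⟩)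
    rwa [hq (i, _)] at hp
  rw [hf'] at hcopy
  exact notMem_empty _ hcopy

/-- A role assignment on `N` vertices in which all sets of size `C log N` contain copies. -/
theorem exists_role_assignment {k : ℕ} (hk : 4 ≤ k) : ∃ C : ℝ, 0 < C ∧ ∀ N : ℕ, k < N →
    ∃ ρ : Fin N → Fin N → Fin k, ∀ A : Finset (Fin N), C * Real.log N < A.card →
      (copies ρ A).Nonempty := by
  set M : ℝ := (k : ℝ) * k * (k : ℝ) ^ (k * k) with hM
  have hk0 : (0 : ℝ) < k := by exact_mod_cast (by omega : 0 < k)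
  have hM0 : 0 < M := by positivity
  refine ⟨k * k * (M + 1), by positivity, fun N hN => ?_⟩
  have hN0 : (0 : ℝ) < N := by exact_mod_cast (by omega : 0 < N)
  have hlog : 1 ≤ Real.log N := by
    rw [Real.le_log_iff_exp_le hN0]
    have : (4 : ℝ) ≤ N := by exact_mod_cast (by omega : 4 ≤ N)
    linarith [Real.exp_one_lt_d9]
  set l := ⌊M * Real.log N⌋₊ + 1 with hl
  have hl1 : M * Real.log N < l := by
    rw [hl]; push_cast; exact Nat.lt_floor_add_one _
  have hl2 : (l : ℝ) ≤ M * Real.log N + 1 := by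
    rw [hl]; push_cast
    have := Nat.floor_le (by positivity : 0 ≤ M * Real.log N)
    linarith
  set m := k * (k * l) with hm
  have hmC : (m : ℝ) ≤ k * k * (M + 1) * Real.log N := by
    rw [hm]; push_cast
    calc (k : ℝ) * (k * l) = k * k * l := by ring
      _ ≤ k * k * ((M + 1) * Real.log N) := by gcongr; linarith
      _ = _ := by ring
  obtain ⟨f, hf⟩ : ∃ f : Fin N × Fin N → Fin k, ∀ A ∈ powersetCard m (univ : Finset (Fin N)),
      copies (fun x y => f (x, y)) A ≠ ∅ := by
    by_contra! hno
    have hcover : (univ : Finset (Fin N × Fin N → Fin k)) ⊆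
        (powersetCard m (univ : Finset (Fin N))).biUnion fun A =>
          univ.filter fun f => copies (fun x y => f (x, y)) A = ∅ := by
      intro f _
      obtain ⟨A, hA, h⟩ := hno f
      exact mem_biUnion.2 ⟨A, hA, mem_filter.2 ⟨mem_univ _, h⟩⟩
    have h1 := (card_le_card hcover).trans card_biUnion_le
    rw [card_univ, Fintype.card_fun, Fintype.card_fin] at h1
    set T : ℝ := (k : ℝ) ^ Fintype.card (Fin N × Fin N) with hT
    have hT0 : 0 < T := by positivity
    have h2 : T ≤ ∑ A ∈ powersetCard m (univ : Finset (Fin N)),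
        ((univ.filter fun f : Fin N × Fin N → Fin k =>
          copies (fun x y => f (x, y)) A = ∅).card : ℝ) := by
      rw [hT]; exact_mod_cast h1
    set p : ℝ := ((k : ℝ) ^ (k * k))⁻¹ with hp
    have hp1 : p ≤ 1 := inv_le_one_of_one_le₀ (one_le_pow₀ (by exact_mod_cast (by omega : 1 ≤ k)))
    have h3 : T ≤ (N : ℝ) ^ m * ((1 - p) ^ (l * l) * T) := by
      refine h2.trans ((sum_le_card_nsmul _ _ _ fun A hA =>
        card_copies_eq_empty_le (by omega) (by omega) (mem_powersetCard.1 hA).2).trans ?_)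
      rw [card_powersetCard, card_univ, Fintype.card_fin, nsmul_eq_mul]
      have h4 : ((N.choose m : ℕ) : ℝ) ≤ (N : ℝ) ^ m := by exact_mod_cast Nat.choose_le_pow N m
      have h5 : 0 ≤ (1 - p) ^ (l * l) * T := mul_nonneg (pow_nonneg (by linarith) _) hT0.le
      gcongr
    have h4 : (1 - p) ^ (l * l) ≤ Real.exp (-(p * (l * l))) := by
      calc (1 - p) ^ (l * l) ≤ Real.exp (-p) ^ (l * l) := by
            refine pow_le_pow_left₀ (by linarith) ?_ _
            linarith [Real.add_one_le_exp (-p)]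
        _ = _ := by rw [← Real.exp_nat_mul]; congr 1; push_cast; ring
    have h5 : (N : ℝ) ^ m = Real.exp (m * Real.log N) := by
      rw [Real.exp_nat_mul, Real.exp_log hN0]
    have h6 : (1 : ℝ) ≤ Real.exp (m * Real.log N) * Real.exp (-(p * (l * l))) := by
      have h7 : 1 * T ≤ (N : ℝ) ^ m * (1 - p) ^ (l * l) * T := by linarith
      have h8 := le_of_mul_le_mul_right h7 hT0
      rw [h5] at h8
      exact h8.trans (by gcongr)
    rw [← Real.exp_add, Real.one_le_exp_iff] at h6
    have hp0 : 0 < p := by positivity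
    have h7 : p * (M * Real.log N) < p * l := by gcongr
    have h8 : p * M = k * k := by rw [hp, hM]; field_simp
    have h9 : (k : ℝ) * k * Real.log N < p * l := by rw [← h8]; linarith
    have hl0 : (0 : ℝ) < l := by exact_mod_cast (by omega : 0 < l)
    have h10 : (m : ℝ) = k * k * l := by rw [hm]; push_cast; ring
    rw [h10] at h6
    nlinarith
  refine ⟨fun x y => f (x, y), fun A hA => ?_⟩
  have hmA : m ≤ A.card := by exact_mod_cast (hmC.trans_lt hA).le
  obtain ⟨B, hBA, hB⟩ := exists_subset_card_eq hmA
  obtain ⟨φ, hφ⟩ := nonempty_iff_ne_empty.2 (hf B (mem_powersetCard.2 ⟨subset_univ _, hB⟩))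
  rw [mem_copies] at hφ
  exact ⟨φ, mem_copies.2 ⟨fun i => hBA (hφ.1 i), hφ.2⟩⟩

/-- The `k`-graph of the vertex sets of the copies. -/
def copyGraph {k : ℕ} {V : Type*} [Fintype V] [DecidableEq V] (hk : 3 ≤ k)
    (ρ : V → V → Fin k) : KGraph k V where
  edges := (copies ρ univ).image fun φ => univ.image φ
  card_eq := by
    intro e he
    obtain ⟨φ, hφ, rfl⟩ := mem_image.1 he
    rw [card_image_of_injective _ ((mem_copies.1 hφ).2.injective hk), card_univ, Fintype.card_fin]

theorem spanned_copyGraph_le {k : ℕ} {V : Type*} [Fintype V] [DecidableEq V] (hk : 3 ≤ k)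
    (ρ : V → V → Fin k) (S : Finset V) : (copyGraph hk ρ).spanned S ≤ (copies ρ S).card := by
  classical
  refine le_trans (card_le_card fun e he => ?_)
    (card_image_le (s := copies ρ S) (f := fun φ => univ.image φ))
  obtain ⟨he, heS⟩ : e ∈ (copyGraph hk ρ).edges ∧ e ⊆ S := by simpa using he
  obtain ⟨φ, hφ, rfl⟩ := mem_image.1 he
  rw [mem_image]
  exact ⟨φ, mem_copies.2 ⟨fun i => heS (mem_image_of_mem φ (mem_univ i)), (mem_copies.1 hφ).2⟩, rfl⟩

theorem not_isIndep_copyGraph {k : ℕ} {V : Type*} [Fintype V] [DecidableEq V] (hk : 3 ≤ k)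
    {ρ : V → V → Fin k} {A : Finset V} (h : (copies ρ A).Nonempty) :
    ¬ (copyGraph hk ρ).IsIndep A := by
  obtain ⟨φ, hφ⟩ := h
  rw [mem_copies] at hφ
  intro hA
  refine hA (univ.image φ) (mem_image.2 ⟨φ, mem_copies.2 ⟨fun i => mem_univ _, hφ.2⟩, rfl⟩) ?_
  intro x hx
  obtain ⟨i, -, rfl⟩ := mem_image.1 hx
  exact hφ.1 i

theorem exists_graph_indepNum_le {k : ℕ} (hk : 4 ≤ k) : ∃ C : ℝ, 0 < C ∧ ∀ N : ℕ, k < N →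
    ∃ H : KGraph k (Fin N), (H.indepNum : ℝ) ≤ C * Real.log N ∧
      ∀ S : Finset (Fin N), H.spanned S ≤ g k S.card := by
  obtain ⟨C, hC, h⟩ := exists_role_assignment hk
  refine ⟨C, hC, fun N hN => ?_⟩
  obtain ⟨ρ, hρ⟩ := h N hN
  refine ⟨copyGraph (by omega) ρ, ?_, fun S =>
    (spanned_copyGraph_le _ ρ S).trans (card_copies_le_g hk ρ S)⟩
  have hlog : 0 ≤ C * Real.log N := mul_nonneg hC.le (Real.log_natCast_nonneg N)
  refine (Nat.le_floor_iff hlog).1 (Finset.sup_le fun A hA => ?_)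
  rw [Nat.le_floor_iff hlog]
  by_contra! hlt
  exact not_isIndep_copyGraph _ (hρ A hlt) (by simpa using hA)

/-! ### Dense relations contain products of good sets -/

theorem exists_subset_card_mul_sum_le {V : Type*} [DecidableEq V] (f : V → ℕ) {l : ℕ}
    (X : Finset V) (hl : l ≤ X.card) :
    ∃ L ⊆ X, L.card = l ∧ l * ∑ x ∈ X, f x ≤ X.card * ∑ x ∈ L, f x := by
  induction hn : X.card generalizing X with
  | zero =>
    rw [hn] at hl
    exact ⟨∅, empty_subset _, by simpa using (Nat.le_zero.1 hl).symm,
      by simp [Nat.le_zero.1 hl]⟩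
  | succ n ih =>
    rcases hl.eq_or_lt with rfl | hlt
    · exact ⟨X, Subset.rfl, rfl, by rw [hn]⟩
    have hne : X.Nonempty := card_pos.1 (by omega)
    obtain ⟨x, hx, hmin⟩ := exists_min_image X f hne
    have hc : (X.erase x).card = n := by rw [card_erase_of_mem hx, hn]; rfl
    obtain ⟨L, hL, hLl, hle⟩ := ih (X.erase x) (by omega) hc
    refine ⟨L, hL.trans (erase_subset _ _), hLl, ?_⟩
    have h1 : f x + ∑ y ∈ X.erase x, f y = ∑ y ∈ X, f y := add_sum_erase X f hx
    have h2 : n * f x ≤ ∑ y ∈ X.erase x, f y := by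
      rw [← hc, ← smul_eq_mul]
      exact card_nsmul_le_sum _ _ _ fun y hy => hmin y (mem_of_mem_erase hy)
    rcases Nat.eq_zero_or_pos n with rfl | hn0
    · have : l = 0 := by omega
      simp [this]
    · refine Nat.le_of_mul_le_mul_left ?_ hn0
      rw [← h1]
      calc n * (l * (f x + ∑ y ∈ X.erase x, f y))
          = l * (n * f x + n * ∑ y ∈ X.erase x, f y) := by ring
        _ ≤ l * (∑ y ∈ X.erase x, f y + n * ∑ y ∈ X.erase x, f y) := by gcongr
        _ = (n + 1) * (l * ∑ y ∈ X.erase x, f y) := by ring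
        _ ≤ (n + 1) * (n * ∑ x ∈ L, f x) := by gcongr
        _ = _ := by ring

theorem exists_card_filter_le_mul {α β : Type*} [DecidableEq β] (s : Finset α) (t : Finset β)
    (F : α → β) (hF : ∀ a ∈ s, F a ∈ t) (ht : t.Nonempty) :
    ∃ b ∈ t, s.card ≤ t.card * (s.filter fun a => F a = b).card := by
  by_contra! h
  have h1 := card_eq_sum_card_fiberwise (f := F) (s := s) (t := t) hF
  have h2 : ∑ b ∈ t, t.card * (s.filter fun a => F a = b).card < ∑ b ∈ t, s.card :=
    sum_lt_sum_of_nonempty ht h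
  rw [← mul_sum, ← h1, sum_const, smul_eq_mul] at h2
  exact lt_irrefl _ h2

/-- A relation of density at least `n ^ (-c)` between sets of size at least `n ^ C` contains a
product of good sets, if all sets of size `n ^ C₀` contain good sets. -/
theorem exists_prod_subset_of_dense (C₀ : ℕ) {m : ℕ} (p : Fin m → ℕ) (c : ℕ) :
    ∃ C : ℕ, ∀ {n : ℕ}, 2 ≤ n → ∀ {V : Type} [DecidableEq V] (X : Fin m → Finset V)
      (good : Fin m → Finset V → Prop) (R : Finset (Fin m → V)),
      (∀ i, ∀ Y ⊆ X i, n ^ C₀ ≤ Y.card → ∃ S ⊆ Y, S.card = p i ∧ good i S) →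
      (∀ i, n ^ C ≤ (X i).card) → R ⊆ Fintype.piFinset X →
      ∏ i, (X i).card ≤ n ^ c * R.card →
      ∃ S : Fin m → Finset V, (∀ i, S i ⊆ X i ∧ (S i).card = p i ∧ good i (S i)) ∧
        Fintype.piFinset S ⊆ R := by
  induction m generalizing c with
  | zero =>
    refine ⟨0, fun {n} hn V _ X good R _ _ hR hd => ?_⟩
    have hR0 : R.Nonempty := by
      rw [← card_pos]
      by_contra! h
      rw [Nat.le_zero.1 h] at hd
      simp at hd
    obtain ⟨r, hr⟩ := hR0
    refine ⟨fun i => i.elim0, fun i => i.elim0, fun f _ => ?_⟩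
    rwa [Subsingleton.elim f r]
  | succ m ih =>
    set d := c + C₀ + 1 with hd
    obtain ⟨C, hC⟩ := ih (fun i => p i.succ) (c + 1 + d * p 0)
    refine ⟨max d C, fun {n} hn V _ X good R hgood hX hR hdens => ?_⟩
    have hn0 : 0 < n := by omega
    set T := Fintype.piFinset fun i : Fin m => X i.succ with hT
    have hTcard : T.card = ∏ i : Fin m, (X i.succ).card := Fintype.card_piFinset _
    let deg : V → ℕ := fun x => (T.filter fun y => Fin.cons x y ∈ R).card
    have hcons : ∀ r ∈ R, r 0 ∈ X 0 ∧ Fin.tail r ∈ T := fun r hr =>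
      ⟨Fintype.mem_piFinset.1 (hR hr) 0,
        Fintype.mem_piFinset.2 fun i => Fintype.mem_piFinset.1 (hR hr) i.succ⟩
    have hRdeg : R.card ≤ ∑ x ∈ X 0, deg x := by
      rw [← card_sigma]
      refine card_le_card_of_injOn (fun r => ⟨r 0, Fin.tail r⟩) (fun r hr => ?_) ?_
      · rw [mem_coe, mem_sigma, mem_filter]
        exact ⟨(hcons r hr).1, (hcons r hr).2, by simpa [Fin.cons_self_tail] using hr⟩
      · intro r _ r' _ h
        rw [Sigma.mk.injEq, heq_eq_eq] at h
        rw [← Fin.cons_self_tail r, ← Fin.cons_self_tail r', h.1, h.2]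
    obtain ⟨L, hLX, hLcard, hL⟩ := exists_subset_card_mul_sum_le deg (X 0) (l := n ^ d)
      ((Nat.pow_le_pow_right hn0 (le_max_left _ _)).trans (hX 0))
    have hX0 : 0 < (X 0).card := lt_of_lt_of_le (by positivity) (hX 0)
    -- the density on `L` is at least the density on `X 0`
    have hLdens : n ^ d * T.card ≤ n ^ c * ∑ x ∈ L, deg x := by
      refine Nat.le_of_mul_le_mul_left ?_ hX0
      rw [Fin.prod_univ_succ, ← hTcard] at hdens
      calc (X 0).card * (n ^ d * T.card) = n ^ d * ((X 0).card * T.card) := by ring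
        _ ≤ n ^ d * (n ^ c * ∑ x ∈ X 0, deg x) :=
            Nat.mul_le_mul_left _ (hdens.trans (Nat.mul_le_mul_left _ hRdeg))
        _ = n ^ c * (n ^ d * ∑ x ∈ X 0, deg x) := by ring
        _ ≤ n ^ c * ((X 0).card * ∑ x ∈ L, deg x) := by gcongr
        _ = _ := by ring
    let co : (Fin m → V) → Finset V := fun y => L.filter fun x => Fin.cons x y ∈ R
    have hdc : ∑ x ∈ L, deg x = ∑ y ∈ T, (co y).card :=
      sum_card_bipartiteAbove_eq_sum_card_bipartiteBelow
        (s := L) (t := T) fun x y => (Fin.cons x y : Fin (m + 1) → V) ∈ R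
    -- many tails `y` are related to at least `n ^ C₀` elements of `L`
    set G := T.filter fun y => n ^ C₀ ≤ (co y).card with hG
    have hsum : ∑ y ∈ T, (co y).card ≤ G.card * n ^ d + T.card * n ^ C₀ := by
      rw [← sum_filter_add_sum_filter_not T fun y => n ^ C₀ ≤ (co y).card]
      refine add_le_add ?_ ?_
      · rw [← smul_eq_mul]
        exact sum_le_card_nsmul _ _ _ fun y _ => hLcard ▸ card_le_card (filter_subset _ _)
      · refine (sum_le_card_nsmul _ _ (n ^ C₀) fun y hy => ?_).trans ?_
        · exact (not_le.1 (mem_filter.1 hy).2).le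
        · rw [smul_eq_mul]
          gcongr
          exact filter_subset _ _
    have hGcard : T.card ≤ n ^ (c + 1) * G.card := by
      have h1 : n ^ d * T.card ≤ n ^ c * (G.card * n ^ d + T.card * n ^ C₀) :=
        hLdens.trans (by rw [hdc]; gcongr)
      have h2 : n ^ d = n ^ c * n ^ C₀ * n := by rw [hd]; ring
      have h3 : 0 < n ^ c * n ^ C₀ := by positivity
      refine Nat.le_of_mul_le_mul_left ?_ h3
      rw [h2] at h1
      have h4 : n ^ c * n ^ C₀ * (2 * T.card) ≤ n ^ c * n ^ C₀ * (n * T.card) := by gcongr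
      have h5 : n ^ c * n ^ C₀ * (n ^ (c + 1) * G.card)
          = n ^ c * (G.card * (n ^ c * n ^ C₀ * n)) := by ring
      rw [h5]
      nlinarith
    have hch : ∀ y, ∃ S : Finset V, y ∈ G → S ⊆ co y ∧ S.card = p 0 ∧ good 0 S := by
      intro y
      by_cases hy : y ∈ G
      · obtain ⟨S, h1, h2⟩ := hgood 0 (co y) ((filter_subset _ _).trans hLX) (mem_filter.1 hy).2
        exact ⟨S, fun _ => ⟨h1, h2⟩⟩
      · exact ⟨∅, fun h => absurd h hy⟩
    choose F hF using hch
    have hTpos : 0 < T.card := by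
      rw [hTcard]
      exact prod_pos fun i _ => lt_of_lt_of_le (by positivity) (hX i.succ)
    have hGne : G.Nonempty := by
      rw [← card_pos]
      by_contra! h
      rw [Nat.le_zero.1 h] at hGcard
      omega
    have hFmem : ∀ y ∈ G, F y ∈ powersetCard (p 0) L := fun y hy =>
      mem_powersetCard.2 ⟨(hF y hy).1.trans (filter_subset _ _), (hF y hy).2.1⟩
    obtain ⟨S₀, hS₀, hS₀card⟩ := exists_card_filter_le_mul G (powersetCard (p 0) L) F hFmem
      (let ⟨y, hy⟩ := hGne; ⟨F y, hFmem y hy⟩)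
    obtain ⟨y₀, hy₀⟩ : (G.filter fun y => F y = S₀).Nonempty := by
      rw [← card_pos]
      by_contra! h
      rw [Nat.le_zero.1 h] at hS₀card
      have := hGne.card_pos
      omega
    rw [mem_filter] at hy₀
    have hgood₀ := hF y₀ hy₀.1
    rw [hy₀.2] at hgood₀
    set R' := T.filter fun y => ∀ x ∈ S₀, (Fin.cons x y : Fin (m + 1) → V) ∈ R with hR'
    have hGR : (G.filter fun y => F y = S₀) ⊆ R' := by
      intro y hy
      rw [mem_filter] at hy
      refine mem_filter.2 ⟨(mem_filter.1 hy.1).1, fun x hx => ?_⟩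
      rw [← hy.2] at hx
      exact (mem_filter.1 ((hF y hy.1).1 hx)).2
    have hdens' : ∏ i : Fin m, (X i.succ).card ≤ n ^ (c + 1 + d * p 0) * R'.card := by
      rw [← hTcard]
      calc T.card ≤ n ^ (c + 1) * G.card := hGcard
        _ ≤ n ^ (c + 1) * ((n ^ d) ^ p 0 * R'.card) := by
            gcongr
            refine hS₀card.trans (Nat.mul_le_mul ?_ (card_le_card hGR))
            rw [card_powersetCard, hLcard]
            exact Nat.choose_le_pow _ _
        _ = _ := by rw [← pow_mul, pow_add]; ring
    obtain ⟨S, hS, hSR⟩ := hC hn (fun i => X i.succ) (fun i => good i.succ) R'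
      (fun i => hgood i.succ)
      (fun i => (Nat.pow_le_pow_right hn0 (le_max_right _ _)).trans (hX i.succ))
      (filter_subset _ _) hdens'
    refine ⟨Fin.cons S₀ S, fun i => ?_, fun f hf => ?_⟩
    · refine Fin.cases ?_ (fun i => ?_) i
      · exact ⟨(mem_powersetCard.1 hS₀).1.trans hLX, hgood₀.2⟩
      · exact hS i
    · rw [Fintype.mem_piFinset] at hf
      have h1 : Fin.tail f ∈ R' := hSR (Fintype.mem_piFinset.2 fun i => hf i.succ)
      have h2 := (mem_filter.1 h1).2 (f 0) (hf 0)
      rwa [Fin.cons_self_tail] at h2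

/-! ### Many red edges when there is no small blue clique -/

/-- If all transversals of `n` blocks of size `M` contain a red `k`-set, some `k` blocks have many
red transversals. -/
theorem exists_blocks_dense {k n M : ℕ} {V : Type*} [DecidableEq V]
    (hM : 0 < M) (u : Fin n × Fin M → V) (hu : Function.Injective u) (red : Finset V → Prop)
    [DecidablePred red]
    (hred : ∀ b : Fin n → Fin M, ∃ e ⊆ univ.image fun j => u (j, b j), e.card = k ∧ red e) :
    ∃ ι : Fin k → Fin n, Function.Injective ι ∧ M ^ k ≤ n ^ k *
      ((Fintype.piFinset fun i => univ.image fun y => u (ι i, y)).filter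
        fun r => red (univ.image r)).card := by
  set I : Finset (Fin k → Fin n) := univ.filter Function.Injective with hI
  have hch : ∀ b : Fin n → Fin M, ∃ ι ∈ I, red (univ.image fun i => u (ι i, b (ι i))) := by
    intro b
    obtain ⟨e, he, hek, hr⟩ := hred b
    have hinj : Function.Injective fun j => u (j, b j) := fun j j' h =>
      congrArg Prod.fst (hu h)
    obtain ⟨J, -, rfl⟩ := subset_image_iff.1 he
    rw [card_image_of_injective _ hinj] at hek
    refine ⟨J.orderEmbOfFin hek, mem_filter.2 ⟨mem_univ _, (J.orderEmbOfFin hek).injective⟩, ?_⟩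
    have : (univ.image fun i => u (J.orderEmbOfFin hek i, b (J.orderEmbOfFin hek i)))
        = J.image fun j => u (j, b j) := by
      conv_rhs => rw [← image_orderEmbOfFin_univ J hek, image_image]
      rfl
    rwa [this]
  choose F hF using hch
  have hIne : I.Nonempty := ⟨F fun _ => ⟨0, hM⟩, (hF _).1⟩
  obtain ⟨ι, hι, hcard⟩ := exists_card_filter_le_mul (univ : Finset (Fin n → Fin M)) I F
    (fun b _ => (hF b).1) hIne
  have hinj : Function.Injective ι := (mem_filter.1 hι).2
  refine ⟨ι, hinj, ?_⟩
  set R := (Fintype.piFinset fun i => univ.image fun y => u (ι i, y)).filter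
        fun r => red (univ.image r) with hR
  have hIcard : I.card ≤ n ^ k := by
    refine (card_le_univ _).trans_eq ?_
    rw [Fintype.card_fun, Fintype.card_fin, Fintype.card_fin]
  -- a transversal is determined by its restrictions to the blocks in and outside the range of `ι`
  have hfib : (univ.filter fun b => F b = ι).card ≤ R.card * M ^ (n - k) := by
    have hc : Fintype.card ({j // j ∉ Set.range ι} → Fin M) = M ^ (n - k) := by
      classical
      rw [Fintype.card_fun, Fintype.card_fin, Fintype.card_subtype_compl, Fintype.card_fin]
      congr 2
      have := Set.card_range_of_injective hinj
      rw [Fintype.card_fin] at this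
      exact this
    rw [← hc, ← card_univ, ← card_product]
    refine card_le_card_of_injOn (fun b => (fun i => u (ι i, b (ι i)), fun j => b j))
      (fun b hb => ?_) ?_
    · rw [mem_coe, mem_filter] at hb
      rw [mem_coe, mem_product]
      refine ⟨mem_filter.2 ⟨Fintype.mem_piFinset.2 fun i => mem_image_of_mem _ (mem_univ _), ?_⟩,
        mem_univ _⟩
      have := (hF b).2
      rwa [hb.2] at this
    · intro b _ b' _ h
      rw [Prod.mk.injEq] at h
      funext j
      by_cases hj : j ∈ Set.range ι
      · obtain ⟨i, rfl⟩ := hj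
        exact congrArg Prod.snd (hu (congrFun h.1 i))
      · exact congrFun h.2 ⟨j, hj⟩
  have hkn : k ≤ n := by simpa using Fintype.card_le_of_injective ι hinj
  rw [card_univ, Fintype.card_fun, Fintype.card_fin, Fintype.card_fin] at hcard
  have h1 : M ^ k * M ^ (n - k) ≤ n ^ k * R.card * M ^ (n - k) := by
    rw [← pow_add, Nat.add_sub_cancel' hkn]
    calc M ^ n ≤ n ^ k * (R.card * M ^ (n - k)) := hcard.trans (Nat.mul_le_mul hIcard hfib)
      _ = _ := by ring
  exact Nat.le_of_mul_le_mul_right h1 (by positivity)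

/-- The red sets of size `k` inside a union of disjoint sets all of whose transversals are red. -/
theorem sum_add_prod_le_card_red {k : ℕ} {V : Type*} [DecidableEq V] (hk : 2 ≤ k)
    (red : Finset V → Prop) [DecidablePred red] (S : Fin k → Finset V)
    (hd : ∀ i j x, x ∈ S i → x ∈ S j → i = j)
    (hS : ∀ r ∈ Fintype.piFinset S, red (univ.image r)) :
    ∑ i, (((S i).powersetCard k).filter red).card + ∏ i, (S i).card
      ≤ (((univ.biUnion S).powersetCard k).filter red).card := by
  have hinj : ∀ r ∈ Fintype.piFinset S, Function.Injective r := fun r hr i j h =>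
    hd i j (r i) (Fintype.mem_piFinset.1 hr i) (h ▸ Fintype.mem_piFinset.1 hr j)
  have h1 : ∑ i, (((S i).powersetCard k).filter red).card
      = (univ.biUnion fun i => ((S i).powersetCard k).filter red).card := by
    rw [card_biUnion]
    intro i _ j _ hij
    rw [Function.onFun, disjoint_left]
    intro e he he'
    rw [mem_filter, mem_powersetCard] at he he'
    obtain ⟨x, hx⟩ : e.Nonempty := card_pos.1 (by omega)
    exact hij (hd i j x (he.1.1 hx) (he'.1.1 hx))
  have h2 : ∏ i, (S i).card = ((Fintype.piFinset S).image fun r => univ.image r).card := by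
    rw [card_image_of_injOn, Fintype.card_piFinset]
    intro r hr r' hr' h
    funext i
    have h3 : r i ∈ univ.image r' := by
      rw [← show univ.image r = univ.image r' from h]
      exact mem_image_of_mem _ (mem_univ _)
    obtain ⟨j, -, hj⟩ := mem_image.1 h3
    have hij : i = j := hd i j (r i) (Fintype.mem_piFinset.1 hr i)
      (hj ▸ Fintype.mem_piFinset.1 hr' j)
    rw [← hj, hij]
  rw [h1, h2, ← card_union_of_disjoint]
  · refine card_le_card (union_subset ?_ ?_)
    · intro e he
      obtain ⟨i, -, he⟩ := mem_biUnion.1 he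
      rw [mem_filter, mem_powersetCard] at he ⊢
      exact ⟨⟨he.1.1.trans (subset_biUnion_of_mem S (mem_univ i)), he.1.2⟩, he.2⟩
    · intro e he
      obtain ⟨r, hr, rfl⟩ := mem_image.1 he
      rw [mem_filter, mem_powersetCard, card_image_of_injective _ (hinj r hr), card_univ,
        Fintype.card_fin]
      refine ⟨⟨fun x hx => ?_, rfl⟩, hS r hr⟩
      obtain ⟨i, -, rfl⟩ := mem_image.1 hx
      exact mem_biUnion.2 ⟨i, mem_univ i, Fintype.mem_piFinset.1 hr i⟩
  · rw [disjoint_left]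
    intro e he he'
    obtain ⟨i, -, he⟩ := mem_biUnion.1 he
    obtain ⟨r, hr, rfl⟩ := mem_image.1 he'
    rw [mem_filter, mem_powersetCard] at he
    have h3 : ∀ j, j = i := fun j => hd j i (r j) (Fintype.mem_piFinset.1 hr j)
      (he.1.1 (mem_image_of_mem _ (mem_univ j)))
    have h4 := (h3 ⟨0, by omega⟩).trans (h3 ⟨1, by omega⟩).symm
    simp at h4

/-- The Erdős–Hajnal bound: in a polynomially large set in which every `n` vertices span a red edge,
some `s` vertices span at least `g k s` red edges. -/
theorem exists_subset_g_le_card_red {k : ℕ} (hk : 2 ≤ k) (s : ℕ) :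
    ∃ C : ℕ, ∀ {n : ℕ}, 2 ≤ n → ∀ {V : Type} [DecidableEq V] (red : Finset V → Prop)
      [DecidablePred red] (X : Finset V), n ^ C ≤ X.card →
      (∀ A ⊆ X, A.card = n → ∃ e ⊆ A, e.card = k ∧ red e) →
      ∃ S ⊆ X, S.card = s ∧ g k s ≤ ((S.powersetCard k).filter red).card := by
  induction s using Nat.strong_induction_on with
  | _ s ih =>
    rcases lt_or_ge s k with hs | hs
    · refine ⟨s, fun {n} hn V _ red _ X hX _ => ?_⟩
      obtain ⟨S, hSX, hS⟩ := exists_subset_card_eq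
        (((Nat.lt_two_pow_self).le.trans (Nat.pow_le_pow_left hn s)).trans hX)
      exact ⟨S, hSX, hS, by rw [g_of_lt hs]; exact Nat.zero_le _⟩
    obtain ⟨p, hp, hsum, hg⟩ := exists_partition_eq_g hk hs
    choose C₁ hC₁ using fun i => ih (p i) (hp i)
    obtain ⟨C, hC⟩ := exists_prod_subset_of_dense (univ.sup C₁) p k
    refine ⟨C + 1, fun {n} hn V _ red _ X hX hred => ?_⟩
    have hn0 : 0 < n := by omega
    set M := n ^ C with hM
    obtain ⟨u, hu, huX⟩ : ∃ u : Fin n × Fin M → V, Function.Injective u ∧ ∀ y, u y ∈ X := by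
      obtain ⟨e⟩ : Nonempty (Fin n × Fin M ↪ X) := by
        refine Function.Embedding.nonempty_of_card_le ?_
        rw [Fintype.card_prod, Fintype.card_fin, Fintype.card_fin, Fintype.card_coe, hM,
          ← pow_succ']
        exact hX
      exact ⟨fun y => e y, Subtype.val_injective.comp e.injective, fun y => (e y).2⟩
    obtain ⟨ι, hι, hR⟩ := exists_blocks_dense (k := k) (by positivity) u hu red fun b => by
      refine hred _ (fun x hx => ?_) ?_
      · obtain ⟨j, -, rfl⟩ := mem_image.1 hx
        exact huX _
      · rw [card_image_of_injective, card_univ, Fintype.card_fin]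
        exact fun j j' h => congrArg Prod.fst (hu h)
    set Y : Fin k → Finset V := fun i => univ.image fun y => u (ι i, y) with hY
    have hYX : ∀ i, Y i ⊆ X := by
      intro i x hx
      obtain ⟨y, -, rfl⟩ := mem_image.1 hx
      exact huX _
    have hYcard : ∀ i, (Y i).card = M := by
      intro i
      rw [hY, card_image_of_injective, card_univ, Fintype.card_fin]
      exact fun y y' h => congrArg Prod.snd (hu h)
    obtain ⟨S, hS, hSR⟩ := hC hn Y
      (fun i S => g k (p i) ≤ ((S.powersetCard k).filter red).card) _
      (fun i Z hZ hZc => hC₁ i hn red Z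
        ((Nat.pow_le_pow_right hn0 (le_sup (mem_univ i))).trans hZc)
        fun A hA => hred A (hA.trans (hZ.trans (hYX i))))
      (fun i => (hYcard i).ge) (filter_subset _ _)
      (by simpa [hYcard] using hR)
    have hd : ∀ i j x, x ∈ S i → x ∈ S j → i = j := by
      intro i j x hi hj
      obtain ⟨y, -, hy⟩ := mem_image.1 ((hS i).1 hi)
      obtain ⟨z, -, hz⟩ := mem_image.1 ((hS j).1 hj)
      exact hι (congrArg Prod.fst (hu (hy.trans hz.symm)))
    refine ⟨univ.biUnion S, biUnion_subset.2 fun i _ => (hS i).1.trans (hYX i), ?_, ?_⟩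
    · rw [card_biUnion, ← hsum]
      · exact sum_congr rfl fun i _ => (hS i).2.1
      · intro i _ j _ hij
        rw [Function.onFun, disjoint_left]
        exact fun x hi hj => hij (hd i j x hi hj)
    · rw [hg]
      refine le_trans ?_ (sum_add_prod_le_card_red hk red S hd
        fun r hr => (mem_filter.1 (hSR hr)).2)
      refine add_le_add (sum_le_sum fun i _ => (hS i).2.2) ?_
      exact (prod_congr rfl fun i _ => (hS i).2.1.symm).le

/-! ### Ramsey numbers -/

/-- The red sets are given as a predicate on all finite sets, to avoid subtypes. -/
theorem redCount_eq {k N : ℕ} (c : EdgeColoring k N) (S : Finset (Fin N))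
    (red : Finset (Fin N) → Prop) [DecidablePred red]
    (hred : ∀ e, red e ↔ ∃ h : e.card = k, c ⟨e, h⟩ = EdgeColor.red) :
    c.redCount S = ((S.powersetCard k).filter red).card := by
  rw [EdgeColoring.redCount, ← Fintype.card_coe, ← Nat.card_eq_fintype_card]
  refine Nat.card_congr
    { toFun := fun e => ⟨e.1.1, mem_filter.2 ⟨mem_powersetCard.2 ⟨e.2.1, e.1.2⟩,
        (hred _).2 ⟨e.1.2, e.2.2⟩⟩⟩
      invFun := fun e => ⟨⟨e.1, (mem_powersetCard.1 (mem_filter.1 e.2).1).2⟩,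
        (mem_powersetCard.1 (mem_filter.1 e.2).1).1, ((hred _).1 (mem_filter.1 e.2).2).2⟩
      left_inv := fun _ => rfl
      right_inv := fun _ => rfl }

theorem exists_arrows_pow {k : ℕ} (hk : 2 ≤ k) (s : ℕ) :
    ∃ C : ℕ, ∀ n, 2 ≤ n → Arrows k s (g k s) n (n ^ C) := by
  obtain ⟨C, hC⟩ := exists_subset_g_le_card_red hk s
  refine ⟨C, fun n hn c => or_iff_not_imp_left.2 fun hblue => ?_⟩
  classical
  set red : Finset (Fin (n ^ C)) → Prop := fun e => ∃ h : e.card = k, c ⟨e, h⟩ = EdgeColor.red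
  obtain ⟨S, -, hS, hg⟩ := hC hn red univ (by simp) (fun A _ hA => by
    push Not at hblue
    obtain ⟨e, heA, he⟩ := hblue A hA
    refine ⟨e.1, heA, e.2, e.2, ?_⟩
    cases h : c ⟨e.1, e.2⟩ with
    | red => rfl
    | blue => exact absurd h he)
  exact ⟨S, hS, by rwa [redCount_eq c S red fun _ => Iff.rfl]⟩

theorem polynomiallyBounded_ramsey_g {k : ℕ} (hk : 2 ≤ k) (s : ℕ) :
    PolynomiallyBounded fun n => ramsey k s (g k s) n := by
  obtain ⟨C, hC⟩ := exists_arrows_pow hk s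
  refine ⟨C, (eventually_ge_atTop 2).mono fun n hn => ?_⟩
  refine (iInf₂_le (n ^ C) (hC n hn)).trans_eq ?_
  push_cast
  rfl

/-- A `k`-graph with few edges on all `s`-sets gives a coloring without large blue cliques. -/
theorem not_arrows_of_graph {k s t n N : ℕ} (H : KGraph k (Fin N)) (hH : H.indepNum < n)
    (hs : ∀ S : Finset (Fin N), S.card = s → H.spanned S ≤ t) : ¬ Arrows k s (t + 1) n N := by
  classical
  intro h
  set c : EdgeColoring k N := fun e => if e.1 ∈ H.edges then EdgeColor.red else EdgeColor.blue
    with hc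
  rcases h c with ⟨A, hA, hblue⟩ | ⟨S, hS, ht⟩
  · have hind : H.IsIndep A := by
      intro e he heA
      have := hblue ⟨e, H.card_eq e he⟩ heA
      simp [hc, he] at this
    have : A.card ≤ H.indepNum := by
      unfold KGraph.indepNum
      exact le_sup (f := Finset.card) (by simpa using hind)
    omega
  · have h1 := hs S hS
    have h2 : c.redCount S ≤ H.spanned S := by
      rw [redCount_eq c S (· ∈ H.edges), KGraph.spanned]
      · refine card_le_card fun e he => ?_
        rw [mem_filter, mem_powersetCard] at he
        simpa using ⟨he.2, he.1.1⟩
      · intro e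
        constructor
        · exact fun he => ⟨H.card_eq e he, by simp [hc, he]⟩
        · rintro ⟨_, he⟩
          by_contra hne
          simp [hc, hne] at he
    omega

theorem indepNum_le_card {k N : ℕ} (H : KGraph k (Fin N)) : H.indepNum ≤ N :=
  Finset.sup_le fun A _ => (card_le_univ A).trans_eq (Fintype.card_fin N)

theorem atLeastExpPower_ramsey {k : ℕ} (hk : 4 ≤ k) (s : ℕ) :
    AtLeastExpPower fun n => ramsey k s (g k s + 1) n := by
  obtain ⟨C, hC, h⟩ := exists_graph_indepNum_le hk
  -- if `N < exp (√n)` and `n > C ^ 2`, then `C log N < C √n < n`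
  refine ⟨1 / 2, by norm_num, ?_⟩
  filter_upwards [eventually_gt_atTop k, eventually_gt_atTop ⌈C ^ 2⌉₊] with n hnk hnC
  have hn0 : (0 : ℝ) < n := by exact_mod_cast (by omega : 0 < n)
  have hmain : (⌈Real.exp ((n : ℝ) ^ (1 / 2 : ℝ))⌉₊ : ℕ∞) ≤ ramsey k s (g k s + 1) n := by
    refine le_iInf₂ fun N hN => Nat.cast_le.2 (Nat.ceil_le.2 ?_)
    by_contra! hlt
    rcases lt_or_ge N n with hNn | hNn
    · -- all edges may be blue
      refine not_arrows_of_graph (k := k) (s := s) (t := g k s) (n := n)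
        ⟨∅, fun e he => absurd he (notMem_empty e)⟩ ((indepNum_le_card _).trans_lt hNn)
        (fun S _ => ?_) hN
      rw [KGraph.spanned, filter_empty]
      exact Nat.zero_le _
    · obtain ⟨H, hH, hHS⟩ := h N (by omega)
      refine not_arrows_of_graph H ?_ (fun S hS => hS ▸ hHS S) hN
      have hN0 : (0 : ℝ) < N := by exact_mod_cast (by omega : 0 < N)
      have h1 : Real.log N < (n : ℝ) ^ (1 / 2 : ℝ) := (Real.log_lt_iff_lt_exp hN0).2 hlt
      rw [← Real.sqrt_eq_rpow] at h1
      have h2 : C < Real.sqrt n := Real.lt_sqrt_of_sq_lt (Nat.lt_of_ceil_lt hnC)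
      have h3 : (H.indepNum : ℝ) < n := by
        have h4 := Real.mul_self_sqrt hn0.le
        nlinarith
      exact_mod_cast h3
  calc ENNReal.ofReal (Real.exp ((n : ℝ) ^ (1 / 2 : ℝ)))
      ≤ ENNReal.ofReal (⌈Real.exp ((n : ℝ) ^ (1 / 2 : ℝ))⌉₊ : ℝ) :=
        ENNReal.ofReal_le_ofReal (Nat.le_ceil _)
    _ = ((⌈Real.exp ((n : ℝ) ^ (1 / 2 : ℝ))⌉₊ : ℕ∞) : ENNReal) := by
        rw [ENNReal.ofReal_natCast, ENat.toENNReal_coe]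
    _ ≤ _ := ENat.toENNReal_le.2 hmain

theorem ramsey_mono {k s t t' : ℕ} (h : t ≤ t') (n : ℕ) : ramsey k s t n ≤ ramsey k s t' n :=
  le_iInf₂ fun N hN => iInf₂_le N fun c => (hN c).imp_right fun ⟨S, hS, hc⟩ => ⟨S, hS, h.trans hc⟩

theorem not_polynomiallyBounded_of_atLeastExpPower {f f' : ℕ → ℕ∞} (hf : AtLeastExpPower f)
    (hff' : ∀ n, f n ≤ f' n) : ¬ PolynomiallyBounded f' := by
  rintro ⟨C, hC⟩
  obtain ⟨c, hc, hf⟩ := hf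
  have h1 := (isLittleO_rpow_exp_atTop ((C : ℝ) / c)).bound (by norm_num : (0 : ℝ) < 1 / 2)
  have h2 : Tendsto (fun n : ℕ => (n : ℝ) ^ c) atTop atTop :=
    (tendsto_rpow_atTop hc).comp tendsto_natCast_atTop_atTop
  obtain ⟨n, hn1, hn2, hn3⟩ := (hC.and (hf.and (h2.eventually h1))).exists
  have h3 : ((n : ℝ) ^ c) ^ ((C : ℝ) / c) = (n : ℝ) ^ C := by
    rw [← Real.rpow_mul (Nat.cast_nonneg n), mul_div_cancel₀ _ hc.ne', Real.rpow_natCast]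
  rw [h3, Real.norm_of_nonneg (by positivity), Real.norm_of_nonneg (Real.exp_pos _).le] at hn3
  have h4 : ENNReal.ofReal (Real.exp ((n : ℝ) ^ c)) ≤ ENNReal.ofReal ((n : ℝ) ^ C) := by
    refine hn2.trans ((ENat.toENNReal_le.2 ((hff' n).trans hn1)).trans_eq ?_)
    rw [ENNReal.ofReal_pow (Nat.cast_nonneg n), ENNReal.ofReal_natCast]
    simp
  rw [ENNReal.ofReal_le_ofReal_iff (by positivity)] at h4
  linarith [Real.exp_pos ((n : ℝ) ^ c)]

theorem isH1_iff {k : ℕ} (hk : 4 ≤ k) (s t : ℕ) : IsH1 k s t ↔ t = g k s + 1 := by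
  constructor
  · rintro ⟨ht, hpoly, hexp⟩
    rcases lt_trichotomy t (g k s + 1) with h | h | h
    · exact absurd (polynomiallyBounded_ramsey_g (by omega) s)
        (not_polynomiallyBounded_of_atLeastExpPower hexp fun n => ramsey_mono (by omega) n)
    · exact h
    · exact absurd hpoly (not_polynomiallyBounded_of_atLeastExpPower
        (atLeastExpPower_ramsey hk s) fun n => ramsey_mono (by omega) n)
  · rintro rfl
    exact ⟨by omega, polynomiallyBounded_ramsey_g (by omega) s, atLeastExpPower_ramsey hk s⟩

end ErdosHajnal

theorem theorem1 (k : ℕ) (hk : 4 ≤ k) :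
    (∀ s : ℕ, k ≤ s → ∀ t : ℕ, ErdosHajnal.IsH1 k s t ↔ t = ErdosHajnal.g k s + 1) ∧
    (∃ C : ℝ, 0 < C ∧ ∀ s : ℕ, k ≤ s → ∀ N : ℕ, k < N →
      ∃ H : ErdosHajnal.KGraph k (Fin N),
        (H.indepNum : ℝ) ≤ C * Real.log N ∧
        ∀ S : Finset (Fin N), S.card = s → H.spanned S ≤ ErdosHajnal.g k s) := by
  refine ⟨fun s _ t => ErdosHajnal.isH1_iff hk s t, ?_⟩
  obtain ⟨C, hC, h⟩ := ErdosHajnal.exists_graph_indepNum_le hk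
  refine ⟨C, hC, fun s _ N hN => ?_⟩
  obtain ⟨H, hH, hS⟩ := h N hN
  exact ⟨H, hH, fun S hs => hs ▸ hS S⟩
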